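/- All graphs are finite, simple and undirected. A nonempty set $S\subseteq V(G)$ is a \emph{defensive alliance} in $G$ if $|N[v]\cap S|\ge |N(v)\setminus S|$ for every $v\in S$; it is a \emph{locally minimal} defensive alliance if, in addition, for no $v\in S$ the set $S\setminus\{v\}$ is a defensive alliance. A tree decomposition $(T,\{X_t\}_{t\in V(T)})$ of $G$, with $T$ rooted at $r$, is \emph{nice} if $X_r=\emptyset$ and every node $t$ is either a leaf with $X_t=\emptyset$, or an introduce node (one child $s$, $X_t=X_s\cup\{v\}$ with $v\notin X_s$), or a forget node (one child $s$, $X_t=X_s\setminus\{v\}$ with $v\in X_s$), or a join node (two children $s_1,s_2$, $X_t=X_{s_1}=X_{s_2}$). Its width is $\max_t|X_t|-1$. \textbf{Theorem.} There is an algorithm (a program for the random access machine with unit-cost addition and truncated subtraction of natural numbers) which, given a graph $G$ with $n\ge 1$ vertices and a nice tree decomposition $(T,\{X_t\})$ of $G$ with $n^{O(1)}$ nodes, computes the maximum size of a locally minimal defensive alliance of $G$ (in particular, one exists) in time $8^k\, n^{O(2^{k+1})}$, for every integer $k\ge 0$ that is at least the width of the decomposition. Precisely: there is one program $P$ such that for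 every $c\in\mathbb N$ there is $C\in\mathbb N$ such that, for all $n\ge 1$, $k\ge 0$, every $n$-vertex graph $G$ and every nice tree decomposition of $G$ with width at most $k$ and at most $c\,n^c$ nodes, $P$ halts on this input within $C\cdot 8^k\cdot n^{C\cdot 2^{k+1}}$ steps and outputs the maximum size of a locally minimal defensive alliance of $G$. The graph is given by its adjacency matrix, and the decomposition by its root, its parent-child matrix and the node-vertex incidence matrix of its bags. -/

import Mathlib

/-! ## Defensive alliances -/

section Alliance

variable {V : Type*}

/-- A nonempty set `S` of vertices is a defensive alliance if `|N(v) \ S| ≤ |N[v] ∩ S|` for every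
`v ∈ S`. -/
def IsDefensiveAlliance (G : SimpleGraph V) (S : Finset V) : Prop :=
  S.Nonempty ∧ ∀ v ∈ S,
    (G.neighborSet v \ (S : Set V)).ncard ≤ (insert v (G.neighborSet v) ∩ (S : Set V)).ncard

/-- A defensive alliance that stops being one whenever a single vertex is removed. -/
def IsLocallyMinimalDefensiveAlliance [DecidableEq V] (G : SimpleGraph V) (S : Finset V) : Prop :=
  IsDefensiveAlliance G S ∧ ∀ v ∈ S, ¬ IsDefensiveAlliance G (S.erase v)

end Alliance

/-! ## Nice tree decompositions -/

section TreeDecomposition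

variable {V ι : Type*}

/-- `(T, X)` is a tree decomposition of `G`, where `X t` is the bag of the node `t` of `T`. -/
structure IsTreeDecomposition (G : SimpleGraph V) (T : SimpleGraph ι) (X : ι → Finset V) :
    Prop where
  isTree : T.IsTree
  vertex_mem : ∀ v, ∃ t, v ∈ X t
  edge_mem : ∀ u v, G.Adj u v → ∃ t, u ∈ X t ∧ v ∈ X t
  connected : ∀ v, (T.induce {t | v ∈ X t}).Connected

/-- In the tree `T` rooted at `r`, the node `s` is a child of the node `t`. -/
def IsChild (T : SimpleGraph ι) (r t s : ι) : Prop :=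
  T.Adj t s ∧ T.dist r s = T.dist r t + 1

/-- A tree decomposition rooted at `r` is nice if the root has an empty bag and every node is a
leaf node (with empty bag), an introduce node, a forget node or a join node. -/
structure IsNiceTreeDecomposition [DecidableEq V] (G : SimpleGraph V) (T : SimpleGraph ι) (r : ι)
    (X : ι → Finset V) : Prop extends IsTreeDecomposition G T X where
  root_bag : X r = ∅
  node : ∀ t,
    ({s | IsChild T r t s} = ∅ ∧ X t = ∅) ∨
    (∃ s v, {s | IsChild T r t s} = {s} ∧ v ∉ X s ∧ X t = insert v (X s)) ∨
    (∃ s v, {s | IsChild T r t s} = {s} ∧ v ∈ X s ∧ X t = (X s).erase v) ∨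
    (∃ s₁ s₂, s₁ ≠ s₂ ∧ {s | IsChild T r t s} = {s₁, s₂} ∧ X t = X s₁ ∧ X t = X s₂)

/-- The width of a tree decomposition: the maximum size of a bag, minus one. -/
def bagWidth [Fintype ι] (X : ι → Finset V) : ℕ :=
  (Finset.univ.sup fun t => (X t).card) - 1

end TreeDecomposition

/-! ## Random access machines with unit costs -/

namespace RAM

/-- Programs of a random access machine. The machine has registers, which a program addresses by
constants, and a memory, which it addresses through the contents of registers. All of them hold
natural numbers; the only arithmetic is addition and truncated subtraction. -/
inductive Program : Type
  | skip
  | const (i a : ℕ)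
  | add (i j l : ℕ)
  | sub (i j l : ℕ)
  | load (i j : ℕ)
  | store (i j : ℕ)
  | seq (p q : Program)
  | ifNonzero (i : ℕ) (p q : Program)
  | whileNonzero (i : ℕ) (p : Program)

/-- Contents of the registers and of the memory. -/
structure State where
  reg : ℕ → ℕ
  mem : ℕ → ℕ

/-- `s.setReg i a` writes the number `a` to register `i`. -/
def State.setReg (s : State) (i a : ℕ) : State :=
  { s with reg := Function.update s.reg i a }

/-- `s.setMem i a` writes the number `a` to the memory cell with address `i`. -/
def State.setMem (s : State) (i a : ℕ) : State :=
  { s with mem := Function.update s.mem i a }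

/-- `Exec p s t s'`: started in the state `s`, the program `p` halts after `t` steps in the state
`s'`. Every elementary instruction and every evaluation of a test is one step. -/
inductive Exec : Program → State → ℕ → State → Prop
  | skip (s : State) : Exec .skip s 1 s
  | const (s : State) (i a : ℕ) : Exec (.const i a) s 1 (s.setReg i a)
  | add (s : State) (i j l : ℕ) : Exec (.add i j l) s 1 (s.setReg i (s.reg j + s.reg l))
  | sub (s : State) (i j l : ℕ) : Exec (.sub i j l) s 1 (s.setReg i (s.reg j - s.reg l))
  | load (s : State) (i j : ℕ) : Exec (.load i j) s 1 (s.setReg i (s.mem (s.reg j)))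
  | store (s : State) (i j : ℕ) : Exec (.store i j) s 1 (s.setMem (s.reg i) (s.reg j))
  | seq {p q : Program} {s s₁ s₂ : State} {t₁ t₂ : ℕ} (hp : Exec p s t₁ s₁)
      (hq : Exec q s₁ t₂ s₂) : Exec (.seq p q) s (t₁ + t₂) s₂
  | if_true {i : ℕ} {p q : Program} {s s' : State} {t : ℕ} (hi : s.reg i ≠ 0)
      (hp : Exec p s t s') : Exec (.ifNonzero i p q) s (1 + t) s'
  | if_false {i : ℕ} {p q : Program} {s s' : State} {t : ℕ} (hi : s.reg i = 0)
      (hq : Exec q s t s') : Exec (.ifNonzero i p q) s (1 + t) s'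
  | while_true {i : ℕ} {p : Program} {s s₁ s₂ : State} {t₁ t₂ : ℕ} (hi : s.reg i ≠ 0)
      (hp : Exec p s t₁ s₁) (hw : Exec (.whileNonzero i p) s₁ t₂ s₂) :
      Exec (.whileNonzero i p) s (1 + t₁ + t₂) s₂
  | while_false {i : ℕ} {p : Program} {s : State} (hi : s.reg i = 0) :
      Exec (.whileNonzero i p) s 1 s

/-- The initial state on an input word: the word stands at the start of the memory, and everything
else is zero. -/
def initial (w : List ℕ) : State where
  reg := fun _ => 0
  mem := fun a => w.getD a 0

/-- On the input word `w`, the program `p` halts after `t` steps with the number `m` in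
register `0`. -/
def Outputs (p : Program) (w : List ℕ) (t m : ℕ) : Prop :=
  ∃ s, Exec p (initial w) t s ∧ s.reg 0 = m

end RAM

/-! ## The input of the algorithm -/

open Classical in
/-- The `0/1` matrix of a relation, row by row. -/
noncomputable def relationMatrix {m n : ℕ} (R : Fin m → Fin n → Prop) : List ℕ :=
  List.ofFn fun p : Fin (m * n) => if R p.divNat p.modNat then 1 else 0

/-- The input word for a graph with a rooted tree decomposition: the number of vertices, the
number of nodes, the root, the adjacency matrix of the graph, the parent-child matrix of the rooted
tree, and the node-vertex incidence matrix of the bags. -/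
noncomputable def inputWord {n N : ℕ} (G : SimpleGraph (Fin n)) (T : SimpleGraph (Fin N))
    (r : Fin N) (X : Fin N → Finset (Fin n)) : List ℕ :=
  [n, N, (r : ℕ)] ++ relationMatrix G.Adj ++ relationMatrix (IsChild T r) ++
    relationMatrix fun t v => v ∈ X t

/-!
A vertex `v` can be removed from a defensive alliance `S` with at least two vertices unless this
destroys the protection of a neighbour of `v` in `S`, that is, unless `v` has a neighbour `u ∈ S`
with `2 |N(u) ∩ S| ≤ deg u`. So local minimality becomes a local condition once the vertices are
coloured with three classes: outside of `S`, inside, and inside with this inequality. A vertex only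
has to know how many of its neighbours are in `S` and how many of them are of the third class. A
dynamic program over the rooted tree keeps these two numbers for the vertices of a bag and therefore
has at most `(3 (n + 1) ^ 2) ^ (k + 1)` states for a bag and a given number of vertices counted so
far. It needs no nice decomposition, since the children of a node can be added one by one. The
reachable states are found by saturation: in each round, those candidates are kept that follow from
the candidates kept in the previous round, which uses nothing but list operations.

For the running time, data are stored as linked cells on a heap to which cells are only appended.
The functions that a program computes in polynomial time on such data are closed under composition
and under the usual operations on lists, so that the program is obtained from the definition of the
dynamic program. As the number of states is not polynomial in the input, it is included in the bound
with respect to which the time is polynomial; then the time is polynomial in `n ^ (k + 1)`.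
-/

namespace RAM

/-- Started in the state `s`, the program `p` halts within `T` steps in a state satisfying `Q`. -/
def Run (p : Program) (s : State) (T : ℕ) (Q : State → Prop) : Prop :=
  ∃ t s', Exec p s t s' ∧ t ≤ T ∧ Q s'

section Run

variable {p q : Program} {s : State} {T T₁ T₂ : ℕ} {Q R : State → Prop}

theorem Run.imp (h : Run p s T₁ Q) (hT : T₁ ≤ T₂) (hQ : ∀ s', Q s' → R s') : Run p s T₂ R := by
  obtain ⟨t, s', he, ht, hq⟩ := h
  exact ⟨t, s', he, ht.trans hT, hQ _ hq⟩

theorem run_skip (h : Q s) : Run .skip s 1 Q := ⟨_, _, .skip s, le_rfl, h⟩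

theorem run_const {i a : ℕ} (h : Q (s.setReg i a)) : Run (.const i a) s 1 Q :=
  ⟨_, _, .const s i a, le_rfl, h⟩

theorem run_add {i j l : ℕ} (h : Q (s.setReg i (s.reg j + s.reg l))) : Run (.add i j l) s 1 Q :=
  ⟨_, _, .add s i j l, le_rfl, h⟩

theorem run_sub {i j l : ℕ} (h : Q (s.setReg i (s.reg j - s.reg l))) : Run (.sub i j l) s 1 Q :=
  ⟨_, _, .sub s i j l, le_rfl, h⟩

theorem run_load {i j : ℕ} (h : Q (s.setReg i (s.mem (s.reg j)))) : Run (.load i j) s 1 Q :=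
  ⟨_, _, .load s i j, le_rfl, h⟩

theorem run_store {i j : ℕ} (h : Q (s.setMem (s.reg i) (s.reg j))) : Run (.store i j) s 1 Q :=
  ⟨_, _, .store s i j, le_rfl, h⟩

theorem run_seq (h : Run p s T₁ fun s₁ => Run q s₁ T₂ Q) : Run (.seq p q) s (T₁ + T₂) Q := by
  obtain ⟨t₁, s₁, h₁, ht₁, t₂, s₂, h₂, ht₂, hQ⟩ := h
  exact ⟨_, _, .seq h₁ h₂, Nat.add_le_add ht₁ ht₂, hQ⟩

theorem run_ifNonzero {i : ℕ} (hp : s.reg i ≠ 0 → Run p s T₁ Q) (hq : s.reg i = 0 → Run q s T₂ Q) :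
    Run (.ifNonzero i p q) s (1 + (T₁ + T₂)) Q := by
  by_cases hi : s.reg i = 0
  · obtain ⟨t, s', h, ht, hQ⟩ := hq hi
    exact ⟨_, _, .if_false hi h, by omega, hQ⟩
  · obtain ⟨t, s', h, ht, hQ⟩ := hp hi
    exact ⟨_, _, .if_true hi h, by omega, hQ⟩

theorem run_while {i : ℕ} {I : ℕ → State → Prop} (hI : ∀ k s, I k s → (s.reg i = 0 ↔ k = 0))
    (hp : ∀ k s, I (k + 1) s → Run p s T (I k)) (k : ℕ) :
    ∀ s, I k s → Run (.whileNonzero i p) s (k * (T + 1) + 1) (I 0) := by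
  induction k with
  | zero => exact fun s hs => ⟨_, _, .while_false ((hI 0 s hs).2 rfl), by omega, hs⟩
  | succ k ih =>
    intro s hs
    obtain ⟨t₁, s₁, h₁, ht₁, hs₁⟩ := hp k s hs
    obtain ⟨t₂, s₂, h₂, ht₂, hs₂⟩ := ih s₁ hs₁
    refine ⟨_, _, .while_true (fun h => k.succ_ne_zero ((hI _ s hs).1 h)) h₁ h₂, ?_, hs₂⟩
    rw [Nat.succ_mul]
    omega

theorem State.reg_setReg (s : State) (i a j : ℕ) :
    (s.setReg i a).reg j = if j = i then a else s.reg j :=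
  Function.update_apply ..

theorem State.mem_setMem (s : State) (i a j : ℕ) :
    (s.setMem i a).mem j = if j = i then a else s.mem j :=
  Function.update_apply ..

@[simp] theorem State.mem_setReg (s : State) (i a : ℕ) : (s.setReg i a).mem = s.mem := rfl

@[simp] theorem State.reg_setMem (s : State) (i a : ℕ) : (s.setMem i a).reg = s.reg := rfl

/-- Copy register `j` to the register `i ≠ j`. -/
def mov (i j : ℕ) : Program := .seq (.const i 0) (.add i j i)

theorem run_mov {i j : ℕ} (hij : j ≠ i) (h : Q (s.setReg i (s.reg j))) : Run (mov i j) s 2 Q := by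
  refine run_seq (run_const (run_add ?_))
  convert h using 1
  simp [State.setReg, Function.update_of_ne hij]

end Run

/-- From `s` to `s'`, the free pointer in register `0` has not decreased, and the heap below it and
the registers below `d` have been kept. -/
structure Ext (d : ℕ) (s s' : State) : Prop where
  reg : ∀ i, 0 < i → i < d → s'.reg i = s.reg i
  free : s.reg 0 ≤ s'.reg 0
  mem : ∀ x < s.reg 0, s'.mem x = s.mem x

namespace Ext

variable {d e : ℕ} {s s₁ s₂ s' : State}

theorem refl (d : ℕ) (s : State) : Ext d s s := ⟨fun _ _ _ => rfl, le_rfl, fun _ _ => rfl⟩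

theorem trans (h : Ext d s s₁) (h' : Ext d s₁ s₂) : Ext d s s₂ :=
  ⟨fun i hi hd => (h'.reg i hi hd).trans (h.reg i hi hd), h.free.trans h'.free,
    fun x hx => (h'.mem x (hx.trans_le h.free)).trans (h.mem x hx)⟩

theorem mono (h : Ext e s s') (hd : d ≤ e) : Ext d s s' :=
  ⟨fun i hi hid => h.reg i hi (hid.trans_le hd), h.free, h.mem⟩

theorem setReg {i : ℕ} (h : Ext d s s') (a : ℕ) (hd : d ≤ i) (hi : 0 < i) :
    Ext d s (s'.setReg i a) := by
  refine h.trans ⟨fun j _ hj => ?_, ?_, fun _ _ => rfl⟩ <;> rw [State.reg_setReg, if_neg (by omega)]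

end Ext

/-- Allocate a cell with the contents of the registers `d + 1` and `d + 2`, and put its address
into register `d`. -/
def allocPair (d : ℕ) : Program :=
  .seq (.store 0 (d + 1)) <| .seq (.const d 1) <| .seq (.add 0 0 d) <| .seq (.store 0 (d + 2)) <|
    .seq (.add 0 0 d) <| .seq (.add d d d) (.sub d 0 d)

theorem run_allocPair {d : ℕ} (hd : 0 < d) (s : State) :
    Run (allocPair d) s 7 fun s' => Ext d s s' ∧ s'.reg d = s.reg 0 ∧ s'.reg 0 = s.reg 0 + 2 ∧
      s'.mem (s.reg 0) = s.reg (d + 1) ∧ s'.mem (s.reg 0 + 1) = s.reg (d + 2) := by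
  refine run_seq (run_store (run_seq (run_const (run_seq (run_add (run_seq (run_store
    (run_seq (run_add (run_seq (run_add (run_sub ?_))))))))))))
  refine ⟨⟨fun i hi hid => ?_, ?_, fun x hx => ?_⟩, ?_⟩
  · simp [State.reg_setReg, hi.ne', hid.ne]
  · simp [State.reg_setReg, hd.ne, Nat.add_assoc]
  · simp [State.reg_setReg, State.mem_setMem, hd.ne, hx.ne, (Nat.lt_succ_of_lt hx).ne]
  · simp [State.reg_setReg, State.mem_setMem, hd.ne, hd.ne']

end RAM

/-! ## Polynomial bounds -/

/-- A function that is bounded by a polynomial. -/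
def PolyBound (p : ℕ → ℕ) : Prop := ∃ C, ∀ B, p B ≤ (B + 2) ^ C

namespace PolyBound

variable {p q : ℕ → ℕ}

theorem id : PolyBound fun B => B := ⟨1, fun B => by simp⟩

theorem const (c : ℕ) : PolyBound fun _ => c :=
  ⟨c, fun B => Nat.lt_two_pow_self.le.trans (Nat.pow_le_pow_left (Nat.le_add_left 2 B) c)⟩

theorem mul (hp : PolyBound p) (hq : PolyBound q) : PolyBound fun B => p B * q B := by
  obtain ⟨C, hC⟩ := hp
  obtain ⟨E, hE⟩ := hq
  exact ⟨C + E, fun B => by rw [pow_add]; exact Nat.mul_le_mul (hC B) (hE B)⟩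

theorem add (hp : PolyBound p) (hq : PolyBound q) : PolyBound fun B => p B + q B := by
  obtain ⟨C, hC⟩ := hp
  obtain ⟨E, hE⟩ := hq
  refine ⟨max C E + 1, fun B => ?_⟩
  calc p B + q B ≤ (B + 2) ^ max C E + (B + 2) ^ max C E := by
        gcongr
        · exact (hC B).trans (Nat.pow_le_pow_right (by omega) (le_max_left C E))
        · exact (hE B).trans (Nat.pow_le_pow_right (by omega) (le_max_right C E))
    _ = (B + 2) ^ max C E * 2 := (Nat.mul_two _).symm
    _ ≤ (B + 2) ^ (max C E + 1) := Nat.mul_le_mul_left _ (Nat.le_add_left 2 B)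

theorem comp (hp : PolyBound p) (hq : PolyBound q) : PolyBound fun B => p (q B) := by
  obtain ⟨C, hC⟩ := hp
  obtain ⟨E, hE⟩ := hq.add (const 2)
  refine ⟨E * C, fun B => (hC _).trans ?_⟩
  rw [pow_mul]
  exact Nat.pow_le_pow_left (hE B) C

end PolyBound

/-- Up to a polynomial increase of the bound, every `a` that satisfies `D` satisfies `E`. -/
def PolyImplies {α : Type} (D E : ℕ → α → Prop) : Prop :=
  ∃ p, PolyBound p ∧ ∀ B a, D B a → E (p B) a

namespace PolyImplies

variable {α β : Type} {D E F : ℕ → α → Prop}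

theorem of_imp (h : ∀ B a, D B a → E B a) : PolyImplies D E := ⟨_, .id, h⟩

theorem refl (D : ℕ → α → Prop) : PolyImplies D D := of_imp fun _ _ h => h

theorem of_forall (c : ℕ) (h : ∀ a, E c a) : PolyImplies D E := ⟨_, .const c, fun _ a _ => h a⟩

theorem map {r : ℕ → ℕ} (hE : PolyImplies D E) (hr : PolyBound r)
    (h : ∀ B a, E B a → F (r B) a) : PolyImplies D F :=
  let ⟨_, hp, hpE⟩ := hE
  ⟨_, hr.comp hp, fun _ _ ha => h _ _ (hpE _ _ ha)⟩

theorem trans_comp {E : ℕ → β → Prop} {F : ℕ → β → Prop} {f : α → β}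
    (h : PolyImplies D fun B a => E B (f a)) (h' : PolyImplies E F) :
    PolyImplies D fun B a => F B (f a) :=
  let ⟨_, hp, hpE⟩ := h'
  h.map hp fun _ _ ha => hpE _ _ ha

theorem trans (h : PolyImplies D E) (h' : PolyImplies E F) : PolyImplies D F :=
  h.trans_comp (f := _root_.id) h'

theorem map₂ {G : ℕ → α → Prop} {r : ℕ → ℕ → ℕ} (hE : PolyImplies D E) (hF : PolyImplies D F)
    (hr : ∀ {p q}, PolyBound p → PolyBound q → PolyBound fun B => r (p B) (q B))
    (h : ∀ B B' a, E B a → F B' a → G (r B B') a) : PolyImplies D G :=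
  let ⟨_, hp, hpE⟩ := hE
  let ⟨_, hq, hqF⟩ := hF
  ⟨_, hr hp hq, fun _ _ ha => h _ _ _ (hpE _ _ ha) (hqF _ _ ha)⟩

theorem and (hE : PolyImplies D E) (hF : PolyImplies D F) (mE : Monotone E) (mF : Monotone F) :
    PolyImplies D fun B a => E B a ∧ F B a :=
  hE.map₂ hF .add fun _ _ _ h h' =>
    ⟨mE (Nat.le_add_right _ _) _ h, mF (Nat.le_add_left _ _) _ h'⟩

end PolyImplies

/-! ## Data in the memory -/

/-- Data that can be stored on the heap of a random access machine. `Stored mem free v a` says that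
the number `v` represents `a`, all cells it refers to being below the address `free`, and
`Bdd B a` that all numbers in `a`, and the lengths of all lists in `a`, are at most `B`. -/
class Code (α : Type) where
  Stored : (ℕ → ℕ) → ℕ → ℕ → α → Prop
  Bdd : ℕ → α → Prop
  stored_mono : ∀ {mem mem' : ℕ → ℕ} {free free' v : ℕ} {a : α}, (∀ x < free, mem' x = mem x) →
    free ≤ free' → Stored mem free v a → Stored mem' free' v a
  bdd_mono : Monotone Bdd

namespace Code

instance : Code ℕ where
  Stored _ _ v a := v = a
  Bdd B a := a ≤ B
  stored_mono _ _ h := h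
  bdd_mono _ _ h _ h' := h'.trans h

instance : Code Bool where
  Stored _ _ v a := v = a.toNat
  Bdd _ _ := True
  stored_mono _ _ h := h
  bdd_mono _ _ _ _ h := h

variable {α β : Type} [Code α] [Code β]

theorem Bdd.mono {B B' : ℕ} {a : α} (h : Bdd B a) (hB : B ≤ B') : Bdd B' a := bdd_mono hB a h

instance : Code (α × β) where
  Stored mem free v a :=
    v ≠ 0 ∧ v + 1 < free ∧ Stored mem free (mem v) a.1 ∧ Stored mem free (mem (v + 1)) a.2
  Bdd B a := Bdd B a.1 ∧ Bdd B a.2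
  stored_mono h hf := fun ⟨h0, h1, h2, h3⟩ => ⟨h0, h1.trans_le hf, by
    rw [h _ (by omega)]; exact stored_mono h hf h2, by rw [h _ h1]; exact stored_mono h hf h3⟩
  bdd_mono _ _ h _ h' := ⟨h'.1.mono h, h'.2.mono h⟩

/-- Representation of a list by linked cells. -/
def ListStored (mem : ℕ → ℕ) (free : ℕ) : ℕ → List α → Prop
  | v, [] => v = 0
  | v, a :: l =>
    v ≠ 0 ∧ v + 1 < free ∧ Stored mem free (mem v) a ∧ ListStored mem free (mem (v + 1)) l

theorem ListStored.mono {mem mem' : ℕ → ℕ} {free free' : ℕ} (h : ∀ x < free, mem' x = mem x)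
    (hf : free ≤ free') : ∀ {v : ℕ} {l : List α},
      ListStored mem free v l → ListStored mem' free' v l
  | _, [], hl => hl
  | _, _ :: _, ⟨h0, h1, h2, h3⟩ => ⟨h0, h1.trans_le hf, by
      rw [h _ (by omega)]; exact stored_mono h hf h2, by rw [h _ h1]; exact h3.mono h hf⟩

instance : Code (List α) where
  Stored mem free v l := ListStored mem free v l
  Bdd B l := l.length ≤ B ∧ ∀ a ∈ l, Bdd B a
  stored_mono h hf h' := h'.mono h hf
  bdd_mono _ _ h _ h' := ⟨h'.1.trans h, fun a ha => (h'.2 a ha).mono h⟩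

theorem bdd_nat {B a : ℕ} : Bdd B a ↔ a ≤ B := Iff.rfl

theorem bdd_of_subset {B : ℕ} {l l' : List α} (h : Bdd B l) (hl : l'.length ≤ l.length)
    (hs : l' ⊆ l) : Bdd B l' :=
  ⟨hl.trans h.1, fun a ha => h.2 a (hs ha)⟩

/-- Register `d` of `s` represents `a`, the free pointer in register `0` being a proper address. -/
def Holds (s : RAM.State) (d : ℕ) (a : α) : Prop :=
  0 < s.reg 0 ∧ Stored s.mem (s.reg 0) (s.reg d) a

namespace Holds

variable {s s' : RAM.State} {d e i : ℕ} {a : α}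

theorem ext (h : Holds s d a) (hs : RAM.Ext e s s') (hd : s'.reg i = s.reg d) : Holds s' i a := by
  refine ⟨h.1.trans_le hs.free, ?_⟩
  rw [hd]
  exact stored_mono hs.mem hs.free h.2

theorem keep (h : Holds s d a) (hs : RAM.Ext e s s') (hd : 0 < d) (he : d < e) : Holds s' d a :=
  h.ext hs (hs.reg d hd he)

theorem mov (h : Holds s d a) (hi : 0 < i) : Holds (s.setReg i (s.reg d)) i a :=
  h.ext ((RAM.Ext.refl i s).setReg _ le_rfl hi) (by rw [RAM.State.reg_setReg, if_pos rfl])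

theorem setReg (h : 0 < s.reg 0) (hi : 0 < i) {v : ℕ} (hv : Stored s.mem (s.reg 0) v a) :
    Holds (s.setReg i v) i a := by
  simpa [Holds, RAM.State.reg_setReg, hi.ne] using ⟨h, hv⟩

end Holds

end Code

open Code RAM

/-! ## Polynomial time -/

/-- The program `P` turns the value `a` of register `d` into `b` within `T` steps; it uses the
registers from `d` on and the heap from the free pointer on. -/
def Computes {α β : Type} [Code α] [Code β] (P : Program) (d T : ℕ) (a : α) (b : β) : Prop :=
  ∀ s, Holds s d a → Run P s T fun s' => Ext d s s' ∧ Holds s' d b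

/-- On arguments with `D B a`, the function `f` is computed in time polynomial in `B`, and its
value is bounded by a polynomial in `B`. -/
def PolyOn {α β : Type} [Code α] [Code β] (D : ℕ → α → Prop) (f : α → β) : Prop :=
  (PolyImplies D fun B a => Bdd B (f a)) ∧
    ∀ d, 0 < d → ∃ P, PolyImplies D fun B a => Computes P d B a (f a)

/-- The function `f` is computed in polynomial time. -/
abbrev PolyTime {α β : Type} [Code α] [Code β] (f : α → β) : Prop := PolyOn Bdd f

section Computes

variable {α β γ : Type} [Code α] [Code β] [Code γ] {P Q : Program} {d T T' : ℕ}
  {a : α} {b : β} {c : γ}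

theorem Computes.seq (h : Computes P d T a b) (h' : Computes Q d T' b c) :
    Computes (.seq P Q) d (T + T') a c := fun s hs =>
  run_seq <| (h s hs).imp le_rfl fun s₁ h₁ =>
    (h' s₁ h₁.2).imp le_rfl fun _ h₂ => ⟨h₁.1.trans h₂.1, h₂.2⟩

/-- Run the program `P`, which works above register `e`, on a copy of register `d`. -/
def RAM.evalAt (e d : ℕ) (P : Program) : Program := .seq (mov e d) P

theorem Computes.evalAt {e : ℕ} (h : Computes P e T a b) (hd : d < e) {s : State}
    (hs : Holds s d a) :
    Run (evalAt e d P) s (2 + T) fun s' => Ext e s s' ∧ Holds s' e b :=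
  run_seq <| run_mov hd.ne <| (h _ (hs.mov (by omega))).imp le_rfl fun _ h =>
    ⟨((Ext.refl e s).setReg _ le_rfl (by omega)).trans h.1, h.2⟩

theorem Computes.test {e : ℕ} {p : Bool} (h : Computes P e T a p) (hd : d < e) {s : State}
    (hs : Holds s d a) :
    Run (RAM.evalAt e d P) s (2 + T) fun s' => Ext e s s' ∧ (s'.reg e ≠ 0 ↔ p = true) :=
  (h.evalAt hd hs).imp le_rfl fun _ ⟨he, _, hp⟩ => ⟨he, by rw [hp]; cases p <;> simp⟩

end Computes

namespace PolyOn

variable {α β γ δ : Type} [Code α] [Code β] [Code γ] [Code δ] {D E : ℕ → α → Prop}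

theorem mono {f : α → β} (hf : PolyOn D f) (h : PolyImplies E D) : PolyOn E f :=
  ⟨h.trans hf.1, fun d hd => let ⟨P, hP⟩ := hf.2 d hd; ⟨P, h.trans hP⟩⟩

theorem congr {f g : α → β} (hf : PolyOn D f) (h : ∀ a, f a = g a) : PolyOn D g :=
  funext h ▸ hf

theorem comp_on {E : ℕ → β → Prop} {g : β → γ} {f : α → β} (hg : PolyOn E g) (hf : PolyOn D f)
    (h : PolyImplies D fun B a => E B (f a)) : PolyOn D fun a => g (f a) := by
  refine ⟨h.trans_comp hg.1, fun d hd => ?_⟩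
  obtain ⟨P, hP⟩ := hf.2 d hd
  obtain ⟨Q, hQ⟩ := hg.2 d hd
  exact ⟨.seq P Q, hP.map₂ (h.trans_comp hQ) .add fun _ _ _ => Computes.seq⟩

theorem comp {g : β → γ} {f : α → β} (hg : PolyTime g) (hf : PolyOn D f) :
    PolyOn D fun a => g (f a) :=
  hg.comp_on hf hf.1

theorem of_computes {f : α → β} (T : ℕ) (hb : PolyImplies D fun B a => Bdd B (f a))
    (h : ∀ d, 0 < d → ∃ P, ∀ a, Computes P d T a (f a)) : PolyOn D f :=
  ⟨hb, fun d hd => let ⟨P, hP⟩ := h d hd; ⟨P, .of_forall T hP⟩⟩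

theorem of_stored {f : α → β} {B : ℕ} (v : ℕ) (hb : ∀ a, Bdd B (f a))
    (hv : ∀ mem free a, Stored mem free v (f a)) : PolyOn D f :=
  of_computes 1 (.of_forall B hb) fun d hd => ⟨.const d v, fun _ s hs =>
    run_const ⟨(Ext.refl d s).setReg _ le_rfl hd, .setReg hs.1 hd (hv _ _ _)⟩⟩

theorem nat (c : ℕ) : PolyOn D fun _ => c :=
  of_stored c (fun _ => bdd_nat.2 le_rfl) fun _ _ _ => rfl

theorem bool (c : Bool) : PolyOn D fun _ => c :=
  of_stored (B := 0) c.toNat (fun _ => trivial) fun _ _ _ => rfl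

theorem nil : PolyOn D fun _ => ([] : List β) :=
  of_stored (B := 0) 0 (fun _ => ⟨le_rfl, fun _ h => absurd h List.not_mem_nil⟩) fun _ _ _ => rfl

theorem of_same_stored {f : α → β} (hb : PolyImplies D fun B a => Bdd B (f a))
    (h : ∀ B a, D B a → ∀ mem free v, Stored mem free v a → Stored mem free v (f a)) :
    PolyOn D f :=
  ⟨hb, fun d _ => ⟨.skip, _, .const 1, fun B a ha s hs =>
    run_skip ⟨.refl d s, hs.1, h B a ha _ _ _ hs.2⟩⟩⟩

theorem id (h : PolyImplies D Bdd) : PolyOn D fun a : α => a :=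
  of_same_stored h fun _ _ _ _ _ _ h => h

theorem fst {f : α → β × γ} (hf : PolyOn D f) : PolyOn D fun a => (f a).1 := by
  refine .comp (g := Prod.fst) (of_computes 1 (.of_imp fun _ _ => And.left) fun d hd =>
    ⟨.load d d, fun _ s hs => run_load ⟨(Ext.refl d s).setReg _ le_rfl hd, ?_⟩⟩) hf
  exact .setReg hs.1 hd hs.2.2.2.1

theorem snd {f : α → β × γ} (hf : PolyOn D f) : PolyOn D fun a => (f a).2 := by
  refine .comp (g := Prod.snd) (of_computes 3 (.of_imp fun _ _ => And.right) fun d hd =>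
    ⟨.seq (.const (d + 1) 1) (.seq (.add d d (d + 1)) (.load d d)), fun _ s hs =>
      run_seq (run_const (run_seq (run_add (run_load ⟨?_, .setReg ?_ hd ?_⟩))))⟩) hf
  · exact (((Ext.refl d s).setReg _ d.le_succ (by omega)).setReg _ le_rfl hd).setReg _ le_rfl hd
  · simpa [State.reg_setReg, hd.ne] using hs.1
  · simpa [State.reg_setReg, hd.ne] using hs.2.2.2.2

theorem binary {f : α → β} {g : α → γ} {op : β → γ → δ} {T : ℕ} {r : ℕ → ℕ → ℕ}
    (hf : PolyOn D f) (hg : PolyOn D g)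
    (hr : ∀ {p q}, PolyBound p → PolyBound q → PolyBound fun B => r (p B) (q B))
    (hb : ∀ B B' b c, Bdd B b → Bdd B' c → Bdd (r B B') (op b c))
    (h : ∀ d, 0 < d → ∃ R, ∀ s b c, Holds s (d + 1) b → Holds s (d + 2) c →
      Run R s T fun s' => Ext d s s' ∧ Holds s' d (op b c)) :
    PolyOn D fun a => op (f a) (g a) := by
  refine ⟨hf.1.map₂ hg.1 hr fun _ _ _ => hb _ _ _ _, fun d hd => ?_⟩
  obtain ⟨P, hP⟩ := hf.2 (d + 1) (by omega)
  obtain ⟨Q, hQ⟩ := hg.2 (d + 2) (by omega)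
  obtain ⟨R, hR⟩ := h d hd
  refine ⟨.seq (evalAt (d + 1) d P) (.seq (evalAt (d + 2) d Q) R),
    hP.map₂ (r := fun B B' => 2 + B + (2 + B' + T)) hQ (fun hp hq =>
      ((PolyBound.const 2).add hp).add (((PolyBound.const 2).add hq).add (.const T)))
      fun B B' a hP hQ s hs => ?_⟩
  refine run_seq <| (hP.evalAt (by omega) hs).imp le_rfl fun s₁ ⟨e₁, h₁⟩ => ?_
  have hs₁ : Holds s₁ d a := hs.keep e₁ hd (by omega)
  refine run_seq <| (hQ.evalAt (by omega) hs₁).imp le_rfl fun s₂ ⟨e₂, h₂⟩ => ?_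
  refine (hR s₂ _ _ (h₁.keep e₂ (by omega) (by omega)) h₂).imp le_rfl fun s₃ ⟨e₃, h₃⟩ => ?_
  exact ⟨((e₁.mono (by omega)).trans (e₂.mono (by omega))).trans e₃, h₃⟩

theorem add {f g : α → ℕ} (hf : PolyOn D f) (hg : PolyOn D g) : PolyOn D fun a => f a + g a :=
  hf.binary hg .add (fun _ _ _ _ => Nat.add_le_add) fun d hd => ⟨.add d (d + 1) (d + 2),
    fun s _ _ hb hc => run_add ⟨(Ext.refl d s).setReg _ le_rfl hd,
      .setReg hb.1 hd (congrArg₂ _ hb.2 hc.2)⟩⟩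

theorem sub {f g : α → ℕ} (hf : PolyOn D f) (hg : PolyOn D g) : PolyOn D fun a => f a - g a :=
  hf.binary hg (r := fun B _ => B) (fun hp _ => hp)
    (fun _ _ _ _ hb _ => (Nat.sub_le _ _).trans hb) fun d hd => ⟨.sub d (d + 1) (d + 2),
    fun s _ _ hb hc => run_sub ⟨(Ext.refl d s).setReg _ le_rfl hd,
      .setReg hb.1 hd (congrArg₂ _ hb.2 hc.2)⟩⟩

theorem pair {f : α → β} {g : α → γ} (hf : PolyOn D f) (hg : PolyOn D g) :
    PolyOn D fun a => (f a, g a) := by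
  refine hf.binary hg (T := 7) .add (fun B B' b c hb hc => ⟨hb.mono (B.le_add_right B'),
    hc.mono (B'.le_add_left B)⟩) fun d hd => ⟨allocPair d, fun s b c hb hc => ?_⟩
  refine (run_allocPair hd s).imp le_rfl fun s' ⟨e, hd', hfree, h1, h2⟩ => ⟨e, ?_⟩
  have hpos := hb.1
  rw [← hd'] at hfree hpos
  refine ⟨hpos.trans_le (by omega), by omega, by omega, ?_, ?_⟩
  · rw [hd', h1]
    exact stored_mono e.mem e.free hb.2
  · rw [hd', h2]
    exact stored_mono e.mem e.free hc.2

theorem cons {f : α → β} {g : α → List β} (hf : PolyOn D f) (hg : PolyOn D g) :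
    PolyOn D fun a => f a :: g a := by
  refine .comp (of_same_stored ⟨_, PolyBound.id.add (.const 1), fun B x hx => ?_⟩
    fun _ _ _ _ _ _ h => h : PolyTime fun x : β × List β => x.1 :: x.2) (hf.pair hg)
  exact ⟨Nat.succ_le_succ hx.2.1, List.forall_mem_cons.2
    ⟨hx.1.mono B.le_succ, fun b hb => (hx.2.2 b hb).mono B.le_succ⟩⟩

theorem uncons [Inhabited β] {f : α → List β} (hf : PolyOn D f) (h : ∀ B a, D B a → f a ≠ []) :
    PolyOn D fun a => ((f a).headI, (f a).tail) := by
  refine comp_on (E := fun B (l : List β) => Bdd B l ∧ l ≠ []) (g := fun l => (l.headI, l.tail))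
    (of_same_stored (.of_imp ?_) ?_) hf ?_
  · rintro B (_ | ⟨b, l⟩) ⟨hl, hne⟩
    · exact absurd rfl hne
    · exact ⟨hl.2 b List.mem_cons_self, bdd_of_subset hl l.length.le_succ (l.subset_cons_self b)⟩
  · rintro B (_ | ⟨b, l⟩) ⟨-, hne⟩ mem free v hv
    · exact absurd rfl hne
    · exact hv
  · obtain ⟨p, hp, hpb⟩ := hf.1
    exact ⟨p, hp, fun B a ha => ⟨hpb B a ha, h B a ha⟩⟩

theorem nonzero {p : β → Bool} (hp : ∀ mem free v b, Stored mem free v b → (v ≠ 0 ↔ p b = true))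
    {f : α → β} (hf : PolyOn D f) : PolyOn D fun a => p (f a) := by
  refine .comp (of_computes (1 + (1 + 1)) (.of_forall 0 fun _ => trivial) fun d hd =>
    ⟨.ifNonzero d (.const d 1) (.const d 0), fun b s hs => run_ifNonzero (fun hi => ?_)
      fun hi => ?_⟩) hf
  · refine run_const ⟨(Ext.refl d s).setReg _ le_rfl hd, .setReg hs.1 hd ?_⟩
    rw [(hp _ _ _ _ hs.2).1 hi]
    rfl
  · refine run_const ⟨(Ext.refl d s).setReg _ le_rfl hd, .setReg hs.1 hd ?_⟩
    rw [Bool.eq_false_iff.2 fun h => (hp _ _ _ _ hs.2).2 h hi]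
    rfl

theorem cond {c : α → Bool} {f g : α → β} (hc : PolyOn D c)
    (hf : PolyOn (fun B a => D B a ∧ c a = true) f)
    (hg : PolyOn (fun B a => D B a ∧ c a = false) g) :
    PolyOn D fun a => if c a then f a else g a := by
  obtain ⟨⟨pf, hpf, hbf⟩, hf⟩ := hf
  obtain ⟨⟨pg, hpg, hbg⟩, hg⟩ := hg
  refine ⟨⟨_, hpf.add hpg, fun B a ha => ?_⟩, fun d hd => ?_⟩
  · dsimp only
    split
    · exact (hbf B a ⟨ha, ‹_›⟩).mono (Nat.le_add_right _ _)
    · exact (hbg B a ⟨ha, Bool.eq_false_iff.2 ‹_›⟩).mono (Nat.le_add_left _ _)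
  obtain ⟨O, qc, hqc, hO⟩ := hc.2 (d + 1) (by omega)
  obtain ⟨P, qf, hqf, hP⟩ := hf d hd
  obtain ⟨Q, qg, hqg, hQ⟩ := hg d hd
  refine ⟨.seq (evalAt (d + 1) d O) (.ifNonzero (d + 1) P Q), _,
    ((PolyBound.const 2).add hqc).add ((PolyBound.const 1).add (hqf.add hqg)),
    fun B a ha s hs => run_seq ?_⟩
  refine ((hO B a ha).test (by omega) hs).imp le_rfl fun s₁ ⟨e₁, h₁⟩ => ?_
  have hs₁ : Holds s₁ d a := hs.keep e₁ hd (by omega)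
  have e₁' : Ext d s s₁ := e₁.mono (by omega)
  refine run_ifNonzero (fun hi => ?_) fun hi => ?_
  · have hca := h₁.1 hi
    simp only [hca, if_true]
    exact (hP B a ⟨ha, hca⟩ s₁ hs₁).imp le_rfl fun _ h => ⟨e₁'.trans h.1, h.2⟩
  · have hca := Bool.eq_false_iff.2 (mt h₁.2 (not_not.2 hi))
    simp only [hca, Bool.false_eq_true, if_false]
    exact (hQ B a ⟨ha, hca⟩ s₁ hs₁).imp le_rfl fun _ h => ⟨e₁'.trans h.1, h.2⟩

theorem ite {c : α → Bool} {f g : α → β} (hc : PolyOn D c) (hf : PolyOn D f) (hg : PolyOn D g) :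
    PolyOn D fun a => if c a then f a else g a :=
  hc.cond (hf.mono (.of_imp fun _ _ h => h.1)) (hg.mono (.of_imp fun _ _ h => h.1))

theorem iterate_while {σ : Type} [Code σ] {E : ℕ → σ → Prop} {c : σ → Bool} {g : σ → σ} {f : α → σ}
    {m : α → ℕ} (hf : PolyOn D f) (hc : PolyTime c) (hg : PolyOn E g)
    (hcm : ∀ a, ∀ i ≤ m a, (c (g^[i] (f a)) = true ↔ i < m a))
    (hm : PolyImplies D fun B a => m a ≤ B)
    (hb : PolyImplies D fun B a => ∀ i ≤ m a, Bdd B (g^[i] (f a)))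
    (hE : PolyImplies D fun B a => ∀ i < m a, E B (g^[i] (f a))) :
    PolyOn D fun a => g^[m a] (f a) := by
  refine ⟨hb.map .id fun B a h => h _ le_rfl, fun d hd => ?_⟩
  obtain ⟨F, qf, hqf, hF⟩ := hf.2 d hd
  obtain ⟨C, qc, hqc, hC⟩ := hc.2 (d + 1) (by omega)
  obtain ⟨G, qg, hqg, hG⟩ := hg.2 d hd
  obtain ⟨pm, hpm, hm⟩ := hm
  obtain ⟨pb, hpb, hb⟩ := hb
  obtain ⟨pE, hpE, hE⟩ := hE
  have hT := (PolyBound.const 2).add (hqc.comp hpb)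
  refine ⟨.seq F (.seq (evalAt (d + 1) d C)
    (.whileNonzero (d + 1) (.seq G (evalAt (d + 1) d C)))), _,
    hqf.add (hT.add ((hpm.mul (((hqg.comp hpE).add hT).add (.const 1))).add (.const 1))),
    fun B a ha s hs => run_seq ?_⟩
  let I : ℕ → State → Prop := fun k s' => k ≤ m a ∧ Ext d s s' ∧
    Holds s' d (g^[m a - k] (f a)) ∧ (s'.reg (d + 1) = 0 ↔ k = 0)
  have test : ∀ k ≤ m a, ∀ s₁, Ext d s s₁ → Holds s₁ d (g^[m a - k] (f a)) →
      Run (evalAt (d + 1) d C) s₁ (2 + qc (pb B)) (I k) := fun k hk s₁ e₁ h₁ => by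
    refine ((hC _ _ (hb B a ha _ (Nat.sub_le _ k))).test (by omega) h₁).imp le_rfl
      fun s₂ ⟨e₂, h₂⟩ => ⟨hk, e₁.trans (e₂.mono (by omega)), h₁.keep e₂ hd (by omega), ?_⟩
    have := hcm a (m a - k) (by omega)
    rw [← not_iff_not, ← ne_eq, h₂, this]
    omega
  refine (hF B a ha s hs).imp le_rfl fun s₁ ⟨e₁, h₁⟩ => run_seq ?_
  refine (test (m a) le_rfl s₁ e₁ (by simpa using h₁)).imp le_rfl fun s₂ h₂ => ?_
  refine (run_while (T := qg (pE B) + (2 + qc (pb B))) (I := I) (fun k s' h => h.2.2.2)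
    (fun k s' ⟨hk, e, h, _⟩ => run_seq ?_) (m a) s₂ h₂).imp ?_ fun s' h => ⟨h.2.1, h.2.2.1⟩
  · refine (hG _ _ (hE B a ha _ (by omega)) s' h).imp le_rfl fun s'' ⟨e', h'⟩ =>
      test k (Nat.le_of_succ_le hk) s'' (e.trans e') ?_
    rwa [← Function.iterate_succ_apply' g, show (m a - (k + 1)).succ = m a - k by omega] at h'
  · have := hm B a ha
    gcongr

end PolyOn

/-! ## Functions computed in polynomial time -/

section Bounds

variable {β : Type} [Code β]

theorem bdd_append {B B' : ℕ} {l l' : List β} (h : Bdd B l) (h' : Bdd B' l') :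
    Bdd (B + B') (l ++ l') :=
  ⟨by simpa using Nat.add_le_add h.1 h'.1, fun b hb => (List.mem_append.1 hb).elim
    (fun hb => (h.2 b hb).mono (Nat.le_add_right _ _))
    fun hb => (h'.2 b hb).mono (Nat.le_add_left _ _)⟩

theorem bdd_flatMap {B B' : ℕ} {ι : Type*} {l : List ι} {g : ι → List β} (hl : l.length ≤ B)
    (hg : ∀ a ∈ l, Bdd B' (g a)) : Bdd (B * B' + B') (l.flatMap g) := by
  refine ⟨?_, fun b hb => ?_⟩
  · rw [List.length_flatMap]
    calc (l.map fun a => (g a).length).sum ≤ l.length * B' := by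
          simpa using List.sum_le_card_nsmul (l.map fun a => (g a).length) B'
            (by simpa using fun a ha => (hg a ha).1)
      _ ≤ B * B' + B' := (Nat.mul_le_mul_right _ hl).trans (Nat.le_add_right _ _)
  · obtain ⟨a, ha, hb⟩ := List.mem_flatMap.1 hb
    exact ((hg a ha).2 b hb).mono (Nat.le_add_left _ _)

end Bounds

namespace PolyOn

section Bool

variable {α β : Type} [Code α] [Code β] {D : ℕ → α → Prop} {p q : α → Bool} {f g : α → ℕ}

theorem not (hp : PolyOn D p) : PolyOn D fun a => !p a :=
  (hp.ite (.bool false) (.bool true)).congr fun a => by cases p a <;> rfl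

theorem and (hp : PolyOn D p) (hq : PolyOn D q) : PolyOn D fun a => p a && q a :=
  (hp.ite hq (.bool false)).congr fun a => by cases p a <;> rfl

theorem or (hp : PolyOn D p) (hq : PolyOn D q) : PolyOn D fun a => p a || q a :=
  (hp.ite (.bool true) hq).congr fun a => by cases p a <;> rfl

theorem le (hf : PolyOn D f) (hg : PolyOn D g) : PolyOn D fun a => decide (f a ≤ g a) :=
  ((hf.sub hg).nonzero (p := fun x => decide (x ≠ 0)) fun _ _ _ _ h => by simp [show _ = _ from h])
    |>.not.congr fun a => by
      rw [Bool.eq_iff_iff]; simp [Nat.sub_eq_zero_iff_le]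

theorem max (hf : PolyOn D f) (hg : PolyOn D g) : PolyOn D fun a => max (f a) (g a) :=
  ((hf.le hg).ite hg hf).congr fun a => by simp [max_def]

theorem isEmpty {f : α → List β} (hf : PolyOn D f) : PolyOn D fun a => (f a).isEmpty := by
  refine (hf.nonzero (p := fun l => !l.isEmpty) fun mem free v l h => ?_).not.congr fun a => by simp
  cases l with
  | nil => simp [show v = 0 from h]
  | cons b l => simp [show v ≠ 0 from h.1]

end Bool

end PolyOn

section Projections

variable {α β : Type} [Code α] [Code β]

theorem polyTime_id : PolyTime fun a : α => a := .id (.refl _)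

theorem polyTime_fst : PolyTime fun x : α × β => x.1 := polyTime_id.fst

theorem polyTime_snd : PolyTime fun x : α × β => x.2 := polyTime_id.snd

end Projections

namespace PolyOn

section Lists

variable {α β γ δ : Type} [Code α] [Code β] [Code γ] [Code δ] {D : ℕ → α → Prop}

theorem uncurry {f : α → β} {g : α → γ} {h : β → γ → δ}
    (hh : PolyTime fun x : β × γ => h x.1 x.2) (hf : PolyOn D f) (hg : PolyOn D g) :
    PolyOn D fun a => h (f a) (g a) :=
  hh.comp (hf.pair hg)

theorem tail [Inhabited β] {f : α → List β} (hf : PolyOn D f) : PolyOn D fun a => (f a).tail := by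
  refine .comp (g := List.tail) ((polyTime_id.isEmpty.cond .nil (g := List.tail) ?_).congr
    fun l => by cases l <;> rfl) hf
  exact ((PolyOn.id (.of_imp fun _ _ h => h.1)).uncons fun B l h => by
    simpa using h.2).snd

theorem headD [Inhabited β] {f : α → List β} {g : α → β} (hf : PolyOn D f) (hg : PolyOn D g) :
    PolyOn D fun a => (f a).headD (g a) := by
  refine .uncurry (h := List.headD) ((polyTime_fst.isEmpty.cond
    (polyTime_snd.mono (.of_imp fun _ _ h => h.1)) (g := fun x => x.1.headI) ?_).congr
      fun ⟨l, b⟩ => by cases l <;> rfl) hf hg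
  exact ((polyTime_fst.mono (.of_imp fun _ _ h => h.1)).uncons fun B x h => by simpa using h.2).fst

theorem foldl [Inhabited β] {f : α → List β} {g : α → γ} {h : α → γ → β → γ} (hf : PolyOn D f)
    (hg : PolyOn D g) (hh : PolyTime fun x : α × γ × β => h x.1 x.2.1 x.2.2)
    (hD : PolyImplies D Bdd)
    (hb : PolyImplies D fun B a => ∀ i, Bdd B (((f a).take i).foldl (h a) (g a))) :
    PolyOn D fun a => (f a).foldl (h a) (g a) := by
  let step : α × List β × γ → α × List β × γ := fun σ => (σ.1, σ.2.1.tail, h σ.1 σ.2.2 σ.2.1.headI)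
  have iter : ∀ a, ∀ i ≤ (f a).length, step^[i] (a, f a, g a) =
      (a, (f a).drop i, ((f a).take i).foldl (h a) (g a)) := by
    intro a i hi
    induction i with
    | zero => simp
    | succ i ih =>
      rw [Function.iterate_succ_apply', ih (by omega), List.take_succ_eq_append_getElem hi,
        List.foldl_append, List.drop_eq_getElem_cons hi]
      rfl
  have bdd : PolyImplies D fun B a => ∀ i ≤ (f a).length, Bdd B (step^[i] (a, f a, g a)) := by
    refine (hD.and (hf.1.and hb (fun _ _ hB _ h => h.mono hB) fun _ _ hB _ h i => (h i).mono hB)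
      bdd_mono fun _ _ hB _ h => ⟨h.1.mono hB, fun i => (h.2 i).mono hB⟩).map .id
      fun B a ⟨ha, hl, hc⟩ i hi => ?_
    rw [iter a i hi]
    exact ⟨ha, bdd_of_subset hl (by simp) (List.drop_subset i _), hc i⟩
  have hstep : PolyOn (fun B σ => Bdd B σ ∧ σ.2.1 ≠ []) step := by
    have hσ : PolyOn (fun B (σ : α × List β × γ) => Bdd B σ ∧ σ.2.1 ≠ []) fun σ => σ :=
      .id (.of_imp fun _ _ h => h.1)
    have hu := hσ.snd.fst.uncons fun _ _ h => h.2
    exact hσ.fst.pair (hu.snd.pair (hh.comp (hσ.fst.pair (hσ.snd.snd.pair hu.fst))))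
  refine (iterate_while ((PolyOn.id hD).pair (hf.pair hg)) (c := fun σ => !σ.2.1.isEmpty)
    polyTime_snd.fst.isEmpty.not hstep (fun a i hi => ?_) (hf.1.map .id fun B a h => h.1) bdd
    (bdd.map .id fun B a h i hi => ⟨h i hi.le, ?_⟩)).snd.snd.congr fun a => ?_
  · simp [iter a i hi]
  · simpa [iter a i hi.le] using hi
  · simp [iter a _ le_rfl]

theorem range {f : α → ℕ} (hf : PolyOn D f) : PolyOn D fun a => List.range (f a) := by
  let step : ℕ × List ℕ → ℕ × List ℕ := fun σ => (σ.1 - 1, (σ.1 - 1) :: σ.2)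
  have iter : ∀ n, ∀ i ≤ n, step^[i] (n, []) = (n - i, List.range' (n - i) i) := by
    intro n i hi
    induction i with
    | zero => rfl
    | succ i ih =>
      rw [Function.iterate_succ_apply', ih (by omega), List.range'_succ,
        show n - (i + 1) + 1 = n - i by omega]
      rfl
  have bdd : ∀ B n, n ≤ B → ∀ i ≤ n, Bdd B (step^[i] (n, [])) := fun B n hn i hi => by
    rw [iter n i hi]
    refine ⟨bdd_nat.2 (by omega), ?_, fun b hb => ?_⟩
    · simpa using hi.trans hn
    · have := (List.mem_range'_1.1 hb).2
      exact bdd_nat.2 (by omega)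
  refine .comp (g := List.range) ((iterate_while (E := Bdd) (polyTime_id.pair .nil)
    (c := fun σ => decide (1 ≤ σ.1)) (.le (.nat 1) polyTime_fst) (m := fun n => n)
    ((polyTime_fst.sub (.nat 1)).pair ((polyTime_fst.sub (.nat 1)).cons polyTime_snd))
    (fun n i hi => ?_) (.of_imp fun _ _ h => h) (.of_imp bdd)
    (.of_imp fun B n hn i hi => bdd B n hn i hi.le)).snd.congr fun n => ?_) hf
  · rw [iter n i hi, decide_eq_true_eq]
    omega
  · rw [iter n n le_rfl, Nat.sub_self, List.range_eq_range']

theorem iterate {f : α → γ} {h : α → γ → γ} {m : α → ℕ} (hf : PolyOn D f) (hm : PolyOn D m)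
    (hh : PolyTime fun x : α × γ => h x.1 x.2) (hD : PolyImplies D Bdd)
    (hb : PolyImplies D fun B a => ∀ i ≤ m a, Bdd B ((h a)^[i] (f a))) :
    PolyOn D fun a => (h a)^[m a] (f a) := by
  refine (foldl (h := fun a c _ => h a c) hm.range hf (hh.comp (polyTime_fst.pair polyTime_snd.fst))
    hD (hb.map .id fun B a h i => ?_)).congr fun a => by rw [List.foldl_const, List.length_range]
  rw [List.foldl_const]
  exact h _ (by simp)

theorem mul {f g : α → ℕ} (hf : PolyOn D f) (hg : PolyOn D g) : PolyOn D fun a => f a * g a := by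
  refine .uncurry (h := (· * ·)) ((iterate (h := fun x c => c + x.2) (.nat 0) polyTime_fst
    (polyTime_snd.add polyTime_fst.snd) (.refl _)
    ⟨_, .mul .id .id, fun B x hx i hi => ?_⟩).congr fun x => by simp) hf hg
  simpa [bdd_nat] using Nat.mul_le_mul (hi.trans hx.1) hx.2

theorem drop [Inhabited β] {f : α → List β} {i : α → ℕ} (hf : PolyOn D f) (hi : PolyOn D i) :
    PolyOn D fun a => (f a).drop (i a) := by
  refine .uncurry (h := fun l i => l.drop i) ((iterate (h := fun _ l => l.tail) polyTime_fst
    polyTime_snd polyTime_snd.tail (.refl _) (.of_imp fun B x hx i _ => ?_)).congr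
    fun x => List.tail_iterate _ _) hf hi
  rw [List.tail_iterate]
  exact bdd_of_subset hx.1 (by simp) (List.drop_subset _ _)

theorem getD [Inhabited β] {f : α → List β} {i : α → ℕ} {g : α → β} (hf : PolyOn D f)
    (hi : PolyOn D i) (hg : PolyOn D g) : PolyOn D fun a => (f a).getD (i a) (g a) :=
  ((hf.drop hi).headD hg).congr fun a => by
    rw [List.headD_eq_getD]
    simp [List.getD_eq_getElem?_getD]

theorem reverseAux [Inhabited β] {f g : α → List β} (hf : PolyOn D f) (hg : PolyOn D g) :
    PolyOn D fun a => (f a).reverseAux (g a) := by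
  refine .uncurry (h := List.reverseAux) ((foldl (h := fun _ l b => b :: l) polyTime_fst
    polyTime_snd (polyTime_snd.snd.cons polyTime_snd.fst) (.refl _)
    ⟨_, .add .id .id, fun B x hx i => ?_⟩).congr fun x => ?_) hf hg
  · rw [List.foldl_flip_cons_eq_append']
    refine bdd_append (bdd_of_subset hx.1 (by simp) fun b hb => ?_) hx.2
    exact List.take_subset _ _ (List.mem_reverse.1 hb)
  · rw [List.foldl_flip_cons_eq_append', List.reverseAux_eq]

theorem reverse [Inhabited β] {f : α → List β} (hf : PolyOn D f) :
    PolyOn D fun a => (f a).reverse :=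
  hf.reverseAux .nil

theorem append [Inhabited β] {f g : α → List β} (hf : PolyOn D f) (hg : PolyOn D g) :
    PolyOn D fun a => f a ++ g a :=
  (hf.reverse.reverseAux hg).congr fun a => by rw [List.reverseAux_eq, List.reverse_reverse]

theorem flatMap [Inhabited β] [Inhabited γ] {f : α → List β} {g : α → β → List γ}
    (hf : PolyTime f) (hg : PolyTime fun x : α × β => g x.1 x.2) :
    PolyTime fun a => (f a).flatMap (g a) := by
  refine (foldl (h := fun a acc b => acc ++ g a b) hf .nil
    (polyTime_snd.fst.append (hg.comp (polyTime_fst.pair polyTime_snd.snd))) (.refl _) ?_).congr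
    fun a => List.flatMap_eq_foldl.symm
  obtain ⟨p, hp, hpf⟩ := hf.1
  obtain ⟨q, hq, hqg⟩ := hg.1
  have hr := hq.comp (PolyBound.id.add hp)
  refine ⟨_, (hp.mul hr).add hr, fun B a ha i => ?_⟩
  rw [← List.flatMap_eq_foldl]
  refine bdd_flatMap ((List.length_take_le' _ _).trans (hpf B a ha).1) fun b hb => ?_
  exact hqg _ (a, b) ⟨ha.mono (Nat.le_add_right _ _),
    ((hpf B a ha).2 b (List.take_subset _ _ hb)).mono (Nat.le_add_left _ _)⟩

theorem map [Inhabited β] [Inhabited γ] {f : α → List β} {g : α → β → γ}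
    (hf : PolyTime f) (hg : PolyTime fun x : α × β => g x.1 x.2) :
    PolyTime fun a => (f a).map (g a) :=
  (hf.flatMap (g := fun a b => [g a b]) (hg.cons .nil)).congr fun _ => List.map_eq_flatMap.symm

theorem filter [Inhabited β] {f : α → List β} {p : α → β → Bool}
    (hf : PolyTime f) (hp : PolyTime fun x : α × β => p x.1 x.2) :
    PolyTime fun a => (f a).filter (p a) := by
  refine (hf.flatMap (g := fun a b => if p a b then [b] else [])
    (hp.ite (polyTime_snd.cons .nil) .nil)).congr fun a => ?_
  induction f a with
  | nil => rfl
  | cons b l ih => by_cases h : p a b <;> simp [h, ih]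

theorem product [Inhabited β] [Inhabited γ] {f : α → List β} {g : α → List γ} (hf : PolyOn D f)
    (hg : PolyOn D g) : PolyOn D fun a => f a ×ˢ g a :=
  .uncurry (h := List.product) (.flatMap
    (g := fun (x : List β × List γ) b => x.2.map (Prod.mk b)) polyTime_fst
    (.map (g := fun x c => (x.2, c)) polyTime_fst.snd (polyTime_fst.snd.pair polyTime_snd))) hf hg

theorem countP [Inhabited β] {f : α → List β} {p : α → β → Bool}
    (hf : PolyTime f) (hp : PolyTime fun x : α × β => p x.1 x.2) :
    PolyTime fun a => (f a).countP (p a) := by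
  have count : ∀ (a : α) (l : List β) (n : ℕ),
      l.foldl (fun n b => if p a b then n + 1 else n) n = n + l.countP (p a) := fun a l => by
    induction l with
    | nil => exact fun n => rfl
    | cons b l ih => exact fun n => by by_cases h : p a b <;> simp [h, ih]; omega
  refine (foldl (h := fun a n b => if p a b then n + 1 else n) hf (.nat 0)
    ((hp.comp (polyTime_fst.pair polyTime_snd.snd)).ite (polyTime_snd.fst.add (.nat 1))
      polyTime_snd.fst) (.refl _) (hf.1.map .id fun B a h i => ?_)).congr fun a => ?_
  · rw [count, Nat.zero_add]
    exact List.countP_le_length.trans ((List.length_take_le' _ _).trans h.1)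
  · rw [count, Nat.zero_add]

theorem length [Inhabited β] {f : α → List β} (hf : PolyOn D f) : PolyOn D fun a => (f a).length :=
  ((polyTime_id.countP (p := fun _ _ => true) (.bool true)).congr fun _ => by simp).comp hf

theorem any [Inhabited β] {f : α → List β} {p : α → β → Bool}
    (hf : PolyTime f) (hp : PolyTime fun x : α × β => p x.1 x.2) :
    PolyTime fun a => (f a).any (p a) :=
  ((PolyOn.nat 1).le (hf.countP hp)).congr fun a => by
    rw [Bool.eq_iff_iff]
    simp [List.one_le_countP_iff]

theorem all [Inhabited β] {f : α → List β} {p : α → β → Bool}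
    (hf : PolyTime f) (hp : PolyTime fun x : α × β => p x.1 x.2) :
    PolyTime fun a => (f a).all (p a) :=
  (hf.any (p := fun a b => !p a b) hp.not).not.congr fun a => by simp [List.all_eq_not_any_not]

end Lists

end PolyOn

section Sections

variable {β : Type}

theorem length_sections_drop_le {L : List (List β)} (hL : [] ∉ L) (i : ℕ) :
    (L.drop i).sections.length ≤ L.sections.length := by
  induction L generalizing i with
  | nil => simp
  | cons l L ih =>
    cases i with
    | zero => rfl
    | succ i =>
      have hl : 0 < l.length := List.length_pos_iff.2 fun h => hL (h ▸ List.mem_cons_self)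
      refine (ih (fun h => hL (List.mem_cons_of_mem _ h)) i).trans ?_
      simpa [List.sections] using Nat.le_mul_of_pos_right L.sections.length hl

theorem sections_eq_foldl_reverse (L : List (List β)) :
    L.sections = L.reverse.foldl (fun S l => S.flatMap fun s => l.map (· :: s)) [[]] := by
  rw [List.foldl_reverse]
  induction L with
  | nil => rfl
  | cons l L ih => rw [List.foldr_cons, ← ih]; rfl

theorem bdd_sections [Code β] {B : ℕ} {L : List (List β)} (hL : Bdd B L)
    (h : L.sections.length ≤ B) : Bdd B L.sections := by
  refine ⟨h, fun s hs => ?_⟩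
  rw [List.mem_sections] at hs
  refine ⟨hs.length_eq ▸ hL.1, fun b hb => ?_⟩
  obtain ⟨l, hl, hbl⟩ : ∃ l ∈ L, b ∈ l := by
    clear hL h
    induction hs with
    | nil => simp at hb
    | cons h _ ih => grind
  exact (hL.2 l hl).2 b hbl

end Sections

theorem foldl_max_spec (a : ℕ) (l : List ℕ) :
    l.foldl max a ∈ a :: l ∧ ∀ b ∈ a :: l, b ≤ l.foldl max a :=
  List.max?_eq_some_iff.1 List.max?_cons'

namespace PolyOn

variable {α β : Type} [Code α] [Code β] {D : ℕ → α → Prop}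

theorem sections [Inhabited β] {f : α → List (List β)} (hf : PolyOn D f)
    (hne : ∀ a, [] ∉ f a) (hb : PolyImplies D fun B a => (f a).sections.length ≤ B) :
    PolyOn D fun a => (f a).sections := by
  refine comp_on (E := fun B L => Bdd B L ∧ [] ∉ L ∧ L.sections.length ≤ B) ?_ hf ?_
  · refine (foldl (h := fun _ S l => S.flatMap fun s => l.map (· :: s))
      (PolyOn.id (.of_imp fun _ _ h => h.1)).reverse (PolyOn.nil.cons .nil)
      (polyTime_snd.fst.flatMap (g := fun x s => (x.2.2 : List β).map (· :: s)) <|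
        polyTime_fst.snd.snd.map (g := fun x b => b :: x.2) (polyTime_snd.cons polyTime_fst.snd))
      (.of_imp fun _ _ h => h.1) (.of_imp ?_)).congr fun L => (sections_eq_foldl_reverse L).symm
    rintro B L ⟨hL, hne, hlen⟩ i
    rw [List.take_reverse, ← sections_eq_foldl_reverse]
    exact bdd_sections (bdd_of_subset hL (by simp) (List.drop_subset _ _))
      ((length_sections_drop_le hne _).trans hlen)
  · exact hf.1.map₂ hb .add fun B B' a h h' =>
      ⟨h.mono (B.le_add_right B'), hne a, h'.trans (B'.le_add_left B)⟩

theorem foldl_max {f : α → List ℕ} {g : α → ℕ} (hf : PolyOn D f) (hg : PolyOn D g) :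
    PolyOn D fun a => (f a).foldl Max.max (g a) := by
  refine .uncurry (h := fun l c => l.foldl Max.max c) (foldl (h := fun _ c b => Max.max c b)
    polyTime_fst polyTime_snd (polyTime_snd.fst.max polyTime_snd.snd) (.refl _)
    (.of_imp fun B x hx i => ?_)) hf hg
  rcases List.mem_cons.1 (foldl_max_spec x.2 (x.1.take i)).1 with h | h
  · exact h.trans_le hx.2
  · exact hx.1.2 _ (List.take_subset _ _ h)

end PolyOn

/-- Types on which equality is decided in polynomial time. -/
class PolyEq (α : Type) [Code α] [DecidableEq α] : Prop where
  polyTime_eq : PolyTime fun x : α × α => decide (x.1 = x.2)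

namespace PolyOn

variable {α β γ : Type} [Code α] [Code β] [Code γ] [DecidableEq β] [DecidableEq γ]
  {D : ℕ → α → Prop}

theorem eq [PolyEq β] {f g : α → β} (hf : PolyOn D f) (hg : PolyOn D g) :
    PolyOn D fun a => decide (f a = g a) :=
  .uncurry (h := fun b c => decide (b = c)) PolyEq.polyTime_eq hf hg

instance : PolyEq ℕ :=
  ⟨((polyTime_fst.le polyTime_snd).and (polyTime_snd.le polyTime_fst)).congr fun x => by
    rw [← Bool.decide_and]
    exact decide_eq_decide.2 le_antisymm_iff.symm⟩

instance [PolyEq β] [PolyEq γ] : PolyEq (β × γ) :=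
  ⟨((polyTime_fst.fst.eq polyTime_snd.fst).and (polyTime_fst.snd.eq polyTime_snd.snd)).congr
    fun x => by rw [← Bool.decide_and]; exact decide_eq_decide.2 Prod.ext_iff.symm⟩

instance [Inhabited β] [PolyEq β] : PolyEq (List β) where
  polyTime_eq := by
    let step : Bool × List β → β → Bool × List β := fun σ b =>
      (σ.1 && !σ.2.isEmpty && decide (σ.2.headD b = b), σ.2.tail)
    have bdd : ∀ {B : ℕ} (l : List β) (σ : Bool × List β), Bdd B σ → Bdd B (l.foldl step σ) := by
      intro B l
      induction l with
      | nil => exact fun σ hσ => hσ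
      | cons b _ ih =>
        exact fun σ hσ => ih _
          ⟨trivial, bdd_of_subset (l' := σ.2.tail) hσ.2 (by simp) (List.tail_subset _)⟩
    have spec : ∀ (l : List β) (σ : Bool × List β),
        ((l.foldl step σ).1 && (l.foldl step σ).2.isEmpty) = (σ.1 && decide (l = σ.2)) := by
      intro l
      induction l with
      | nil => rintro ⟨c, _ | ⟨b', l'⟩⟩ <;> simp
      | cons b l ih =>
        rintro ⟨c, _ | ⟨b', l'⟩⟩ <;> rw [List.foldl_cons, ih] <;> grind
    have hfold : PolyTime fun x : List β × List β => x.1.foldl step (true, x.2) :=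
      foldl (h := fun _ => step) polyTime_fst ((PolyOn.bool true).pair polyTime_snd)
        (((polyTime_snd.fst.fst.and polyTime_snd.fst.snd.isEmpty.not).and
          ((polyTime_snd.fst.snd.headD polyTime_snd.snd).eq polyTime_snd.snd)).pair
            polyTime_snd.fst.snd.tail)
        (.refl _) (.of_imp fun B x hx i => bdd _ _ ⟨trivial, hx.2⟩)
    exact (hfold.fst.and hfold.snd.isEmpty).congr fun x => by rw [spec]; simp

theorem decide_mem [Inhabited β] [PolyEq β] {f : α → β} {g : α → List β} (hf : PolyOn D f)
    (hg : PolyOn D g) : PolyOn D fun a => decide (f a ∈ g a) :=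
  .uncurry (h := fun b l => decide (b ∈ l)) ((polyTime_snd.any
    (p := fun x c => decide (x.1 = c)) (polyTime_fst.fst.eq polyTime_snd)).congr fun x => by
      rw [Bool.eq_iff_iff]; simp) hf hg

end PolyOn

/-! ## Reading the input word -/

/-- A word of numbers that stands at the start of the memory instead of being a linked list. -/
structure Word where
  toList : List ℕ

instance : Code Word where
  Stored mem free v w :=
    v = w.toList.length ∧ v ≤ free ∧ ∀ i < v, mem i = w.toList.getD i 0
  Bdd B w := Bdd B w.toList
  stored_mono h hf := fun ⟨hv, hf', hw⟩ =>
    ⟨hv, hf'.trans hf, fun i hi => (h i (hi.trans_le hf')).trans (hw i hi)⟩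
  bdd_mono _ _ h _ h' := h'.mono h

theorem polyTime_word_length : PolyTime fun w : Word => w.toList.length :=
  .of_same_stored (.of_imp fun _ _ h => h.1) fun _ _ _ _ _ _ h => h.1

theorem polyOn_word_getD :
    PolyOn (fun B (x : Word × ℕ) => Bdd B x ∧ decide (x.2 + 1 ≤ x.1.toList.length) = true)
      fun x => x.1.toList.getD x.2 0 := by
  refine ⟨.of_imp fun B x hx => ?_, fun d hd =>
    ⟨.seq (.const (d + 1) 1) (.seq (.add d d (d + 1)) (.seq (.load d d) (.load d d))), _, .const 4,
      fun B x hx s hs => run_seq (run_const (run_seq (run_add (run_seq (run_load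
        (run_load ⟨?_, .setReg ?_ hd ?_⟩))))))⟩⟩
  · dsimp only
    rw [List.getD_eq_getElem _ _ (of_decide_eq_true hx.2)]
    exact hx.1.1.2 _ (List.getElem_mem _)
  · exact ((((Ext.refl d s).setReg _ d.le_succ (by omega)).setReg _ le_rfl hd).setReg _ le_rfl
      hd).setReg _ le_rfl hd
  · simpa [State.reg_setReg, hd.ne] using hs.1
  · obtain ⟨-, -, -, ⟨hv, -, hw⟩, hi⟩ := hs
    have hi : s.mem (s.reg d + 1) = x.2 := hi
    simpa [State.reg_setReg, hi, Stored] using hw x.2 (hv ▸ of_decide_eq_true hx.2)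

theorem polyTime_word_toList : PolyTime Word.toList := by
  have h : PolyTime fun x : Word × ℕ => x.1.toList.getD x.2 0 :=
    (((polyTime_snd.add (.nat 1)).le (polyTime_word_length.comp polyTime_fst)).cond
      polyOn_word_getD (.nat 0)).congr fun x => by
        by_cases h : x.2 < x.1.toList.length <;> simp [h]
  refine (polyTime_word_length.range.map (g := fun (w : Word) i => w.toList.getD i 0) h).congr
    fun w => List.ext_getElem (by simp) fun i _ hi => ?_
  simp [List.getElem?_eq_getElem hi]

namespace RAM

/-- Add the product of the registers `1` and `j` to register `0`. -/
def mulAcc (j : ℕ) : Program :=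
  .whileNonzero 1 (.seq (.add 0 0 j) (.seq (.const 5 1) (.sub 1 1 5)))

theorem run_mulAcc {j : ℕ} (hj : 1 < j) (hj' : j < 5) (s : State) :
    Run (mulAcc j) s (s.reg 1 * 4 + 1) fun s' => s'.mem = s.mem ∧
      (∀ i, 1 < i → i < 5 → s'.reg i = s.reg i) ∧
      s'.reg 0 = s.reg 0 + s.reg 1 * s.reg j := by
  let I : ℕ → State → Prop := fun k s' => s'.reg 1 = k ∧ s'.mem = s.mem ∧
    (∀ i, 1 < i → i < 5 → s'.reg i = s.reg i) ∧
    s'.reg 0 + k * s.reg j = s.reg 0 + s.reg 1 * s.reg j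
  refine (run_while (I := I) (T := 3) (fun k s' h => by rw [h.1]) ?_ (s.reg 1) s
    ⟨rfl, rfl, fun _ _ _ => rfl, rfl⟩).imp le_rfl
      fun s' ⟨_, hm, hr, h⟩ => ⟨hm, hr, by simpa using h⟩
  rintro k s' ⟨h1, hm, hr, h⟩
  refine run_seq (run_add (run_seq (run_const (run_sub ⟨?_, hm, fun i hi hi' => ?_, ?_⟩))))
  · simp [State.reg_setReg, h1]
  · simpa [State.reg_setReg, hi.ne', hi'.ne, (Nat.zero_lt_of_lt hi).ne'] using hr i hi hi'
  · rw [← h]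
    simp only [State.reg_setReg, reduceIte, OfNat.zero_ne_ofNat, zero_ne_one, hr j hj hj']
    ring

/-- Put the length of an input word for a graph with a rooted tree decomposition into the registers
`0` and `1`. -/
def measureInput : Program :=
  .seq (.const 1 0) <| .seq (.load 2 1) <| .seq (.const 1 1) <| .seq (.load 3 1) <|
    .seq (.const 0 3) <| .seq (mov 1 2) <| .seq (mulAcc 2) <| .seq (.add 4 3 2) <|
      .seq (mov 1 3) <| .seq (mulAcc 4) (mov 1 0)

theorem run_measureInput (s : State) :
    Run measureInput s (4 * s.mem 0 + 4 * s.mem 1 + 14) fun s' => s'.mem = s.mem ∧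
      s'.reg 1 = s'.reg 0 ∧
      s'.reg 0 = 3 + s.mem 0 * s.mem 0 + s.mem 1 * (s.mem 1 + s.mem 0) := by
  suffices h : Run measureInput s (1 + (1 + (1 + (1 + (1 + (2 + (s.mem 0 * 4 + 1 + (1 + (2 +
      (s.mem 1 * 4 + 1 + 2)))))))))) fun s' => s'.mem = s.mem ∧ s'.reg 1 = s'.reg 0 ∧
      s'.reg 0 = 3 + s.mem 0 * s.mem 0 + s.mem 1 * (s.mem 1 + s.mem 0) from
    h.imp (by omega) fun _ h => h
  refine run_seq <| run_const <| run_seq <| run_load <| run_seq <| run_const <| run_seq <|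
    run_load <| run_seq <| run_const <| run_seq <| run_mov (by omega) <| run_seq <|
    (run_mulAcc (by omega) (by omega) _).imp ?_ ?_
  · simp [State.reg_setReg]
  rintro s₁ ⟨hm, hr, h0⟩
  simp only [State.mem_setReg] at hm
  have h2 : s₁.reg 2 = s.mem 0 := hr 2 (by omega) (by omega)
  have h3 : s₁.reg 3 = s.mem 1 := hr 3 (by omega) (by omega)
  have h0 : s₁.reg 0 = 3 + s.mem 0 * s.mem 0 := h0
  refine run_seq <| run_add <| run_seq <| run_mov (by omega) <| run_seq <|
    (run_mulAcc (by omega) (by omega) _).imp ?_ ?_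
  · simp [State.reg_setReg, h3]
  rintro s₂ ⟨hm', -, h0'⟩
  refine run_mov (by omega) ?_
  simp [State.reg_setReg, hm', hm, h0', h0, h2, h3]

end RAM

theorem exists_program {D : ℕ → List ℕ → Prop} {f : List ℕ → ℕ} (hf : PolyOn D f)
    (hD : ∀ B w, D B w → Bdd B w) : ∃ P C, ∀ B w, D B w →
      w.length = 3 + w.getD 0 0 * w.getD 0 0 + w.getD 1 0 * (w.getD 1 0 + w.getD 0 0) →
      ∃ t ≤ (B + 2) ^ C, Outputs P w t (f w) := by
  obtain ⟨P, p, hp, hP⟩ := (hf.comp_on (polyTime_word_toList.mono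
    (E := fun B w => D B w.toList) (.of_imp fun B w => hD B _)) (.refl _)).2 1 one_pos
  obtain ⟨C, hC⟩ := ((((PolyBound.const 4).mul .id).add ((PolyBound.const 4).mul .id)).add
    (.const 14)).add (hp.add (.const 2))
  refine ⟨.seq measureInput (.seq P (mov 0 1)), C, fun B w hw hlen => ?_⟩
  have getD_le : ∀ i < w.length, w.getD i 0 ≤ B := fun i hi => by
    rw [List.getD_eq_getElem _ _ hi]
    exact (hD B w hw).2 _ (List.getElem_mem hi)
  obtain ⟨t, s, he, ht, hs⟩ : Run (.seq measureInput (.seq P (mov 0 1))) (initial w)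
      (4 * B + 4 * B + 14 + (p B + 2)) fun s => s.reg 0 = f w := by
    refine run_seq ((run_measureInput (initial w)).imp ?_ fun s₁ ⟨hm, h1, h0⟩ => run_seq ?_)
    · have := getD_le 0 (by omega)
      have := getD_le 1 (by omega)
      simp only [initial]
      omega
    have h0 : s₁.reg 0 = w.length := h0.trans hlen.symm
    have hs₁ : Holds s₁ 1 (Word.mk w) :=
      ⟨by omega, h1.trans h0, h1.le, fun i _ => congrFun hm i⟩
    exact (hP B ⟨w⟩ hw s₁ hs₁).imp le_rfl fun s₂ h₂ => run_mov (by omega) h₂.2.2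
  exact ⟨t, ht.trans (hC B), s, he, hs⟩

/-! ## The dynamic program -/

/-- A graph on the vertices below `n` together with a rooted tree on the nodes below `N` and its
bags, all of them given by Boolean relations between natural numbers. -/
structure DecompData where
  n : ℕ
  N : ℕ
  r : ℕ
  adj : ℕ → ℕ → Bool
  child : ℕ → ℕ → Bool
  bag : ℕ → ℕ → Bool

/-- The class of a vertex (`0`: outside of the alliance; `1`: inside; `2`: inside and marginally
protected), the number of its neighbours in the alliance, and the number of its neighbours of
class `2`, where only neighbours from some set of vertices are counted. -/
abbrev Entry : Type := ℕ × ℕ × ℕ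

/-- The number of vertices of the alliance in some set, and the entries of all vertices. -/
abbrev Profile : Type := ℕ × List Entry

/-- A node `t`, a number `j` and a profile on the bag of `t`, which counts the vertices that have
been forgotten below the children of `t` less than `j`. -/
abbrev Record : Type := ℕ × ℕ × Profile

instance : DecidableEq Record := instDecidableEqProd

namespace DecompData

open Finset

/-- The entry of the vertex `u` in the profile `p`. -/
def entry (p : Profile) (u : ℕ) : Entry := p.2.getD u (0, 0, 0)

/-- The class of the vertex `u` in the profile `p`. -/
def cls (p : Profile) (u : ℕ) : ℕ := (entry p u).1

/-- The local condition at a vertex of class `κ` and degree `δ` that has `a` neighbours in the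
alliance, `d` of them of class `2`: it is protected, marginally so if its class is `2`, and one of
its neighbours is marginally protected. -/
def isGood (κ δ a d : ℕ) : Bool :=
  decide (κ = 0 ∨ (δ ≤ a + a + 1 ∧ 1 ≤ d) ∧ (κ ≤ 1 ∨ a + a ≤ δ))

/-- Combine the profiles of two disjoint sets of vertices. -/
def join (p q : Profile) (n : ℕ) : Profile :=
  (p.1 + q.1, (List.range n).map fun u =>
    (cls p u, (entry p u).2.1 + (entry q u).2.1, (entry p u).2.2 + (entry q u).2.2))

variable (I : DecompData)

/-- The bag of the node `t`. -/
def bagSet (t : ℕ) : Finset ℕ := {v ∈ range I.n | I.bag t v}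

/-- The degree of the vertex `v`. -/
def deg (v : ℕ) : ℕ := #{u ∈ range I.n | I.adj v u}

/-- The number of neighbours of `u` in `D` whose class is at least `c`. -/
def nb (σ : ℕ → ℕ) (D : Finset ℕ) (c u : ℕ) : ℕ := #{v ∈ D | I.adj u v ∧ c ≤ σ v}

/-- The number of vertices of the alliance in `D`. -/
def size (σ : ℕ → ℕ) (D : Finset ℕ) : ℕ := #{v ∈ D | 1 ≤ σ v}

/-- The profile on the bag `B` of the classes `σ`, where vertices in `D` are counted. -/
def profile (σ : ℕ → ℕ) (B D : Finset ℕ) : Profile :=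
  (size σ D, (List.range I.n).map fun u =>
    if u ∈ B then (σ u, I.nb σ D 1 u, I.nb σ D 2 u) else (0, 0, 0))

/-- On the way from the node `s` to the node `t`, forget the vertices that are not in the bag
of `t`. -/
def forget (t s : ℕ) (p : Profile) : Profile :=
  (p.1 + size (cls p) (I.bagSet s \ I.bagSet t), (List.range I.n).map fun u =>
    if u ∈ I.bagSet s ∩ I.bagSet t then
      (cls p u, (entry p u).2.1 + I.nb (cls p) (I.bagSet s \ I.bagSet t) 1 u,
        (entry p u).2.2 + I.nb (cls p) (I.bagSet s \ I.bagSet t) 2 u)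
    else (0, 0, 0))

/-- The vertices that are forgotten between `s` and `t` satisfy the local condition. -/
def isClosed (t s : ℕ) (p : Profile) : Bool :=
  decide (∀ u ∈ I.bagSet s \ I.bagSet t, isGood (cls p u) (I.deg u)
    ((entry p u).2.1 + I.nb (cls p) (I.bagSet s) 1 u)
    ((entry p u).2.2 + I.nb (cls p) (I.bagSet s) 2 u) = true)

/-- The profiles `p` on the bag of `t` and `q` on the bag of `s` have the same classes. -/
def isCompatible (t s : ℕ) (p q : Profile) : Bool :=
  decide (∀ u ∈ I.bagSet s ∩ I.bagSet t, cls p u = cls q u)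

/-- The profile `p'` for `(t, j + 1)` arises from a profile `p` for `(t, j)` and a profile `q` for
the child `j` of `t`. -/
def isStep (t j : ℕ) (p q p' : Profile) : Bool :=
  I.isClosed t j q && I.isCompatible t j p q && decide (p' = join p (I.forget t j q) I.n)

/-- The profile `p'` for `(t, j + 1)` arises from two records in `T`. -/
def isStepFrom (T : List Record) (t j : ℕ) (p' : Profile) : Bool :=
  T.any fun f => decide (f.1 = t ∧ f.2.1 = j) &&
    T.any fun g => decide (g.1 = j ∧ g.2.1 = I.N) && I.isStep t j f.2.2 g.2.2 p'

/-- The record `x` follows from the records in the list `T`. -/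
def follows (T : List Record) : Record → Bool
  | (t, 0, p) => decide (p = I.profile (cls p) (I.bagSet t) ∅)
  | (t, j + 1, p) =>
    if I.child t j then I.isStepFrom T t j p else decide ((t, j, p) ∈ T)

/-- The possible entries of the vertex `v` in a profile on the bag of `t`. -/
def options (t v : ℕ) : List Entry :=
  if I.bag t v then List.range 3 ×ˢ (List.range (I.n + 1) ×ˢ List.range (I.n + 1))
  else [(0, 0, 0)]

/-- The possible lists of entries in a profile on the bag of `t`. -/
def states (t : ℕ) : List (List Entry) := ((List.range I.n).map (I.options t)).sections

/-- All candidates for records. -/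
def candidates : List Record :=
  (List.range I.N).flatMap fun t =>
    [t] ×ˢ (List.range (I.N + 1) ×ˢ (List.range (I.n + 1) ×ˢ I.states t))

/-- The records that are derived in `i` rounds. -/
def table (i : ℕ) : List Record := (fun T => I.candidates.filter (I.follows T))^[i] []

/-- The result of the algorithm; forgetting the root on the way to the node `N`, whose bag is empty,
completes a record. The value `1` stands for the alliances with a single vertex, which do not
satisfy the local condition. -/
def answer : ℕ :=
  (((I.table (I.N * (I.N + 1))).filter fun x =>
    decide (x.1 = I.r ∧ x.2.1 = I.N) && I.isClosed I.N I.r x.2.2).map fun x =>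
      (I.forget I.N I.r x.2.2).1).foldl max 1

/-! ## Profiles of classes -/

/-- The local condition at the vertex `u` for the classes `σ`. -/
def Good (σ : ℕ → ℕ) (u : ℕ) : Prop :=
  isGood (σ u) (I.deg u) (I.nb σ (range I.n) 1 u) (I.nb σ (range I.n) 2 u) = true

variable {I} {σ τ : ℕ → ℕ} {B D E : Finset ℕ} {c u v t s : ℕ}

theorem mem_bagSet : v ∈ I.bagSet t ↔ v < I.n ∧ I.bag t v = true := by simp [bagSet]

theorem bagSet_subset : I.bagSet t ⊆ range I.n := filter_subset ..

theorem nb_congr (h : ∀ v ∈ D, I.adj u v = true → σ v = τ v) : I.nb σ D c u = I.nb τ D c u :=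
  congrArg card <| filter_congr fun v hv => and_congr_right fun ha => by rw [h v hv ha]

theorem nb_union (h : Disjoint D E) : I.nb σ (D ∪ E) c u = I.nb σ D c u + I.nb σ E c u := by
  rw [nb, filter_union, card_union_of_disjoint (disjoint_filter_filter h), nb, nb]

theorem nb_subset (h : E ⊆ D) (hD : ∀ v ∈ D, I.adj u v = true → v ∈ E) :
    I.nb σ D c u = I.nb σ E c u :=
  congrArg card <| Subset.antisymm
    (fun v hv => by
      obtain ⟨hv, ha, hc⟩ := mem_filter.1 hv
      exact mem_filter.2 ⟨hD v hv ha, ha, hc⟩)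
    (filter_subset_filter _ h)

theorem nb_le (h : D ⊆ range I.n) : I.nb σ D c u ≤ I.n :=
  (card_filter_le _ _).trans ((card_le_card h).trans_eq (card_range _))

theorem size_congr (h : ∀ v ∈ D, σ v = τ v) : size σ D = size τ D :=
  congrArg card <| filter_congr fun v hv => by rw [h v hv]

theorem size_union (h : Disjoint D E) : size σ (D ∪ E) = size σ D + size σ E := by
  rw [size, filter_union, card_union_of_disjoint (disjoint_filter_filter h), size, size]

theorem size_le (h : D ⊆ range I.n) : size σ D ≤ I.n :=
  (card_filter_le _ _).trans ((card_le_card h).trans_eq (card_range _))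

theorem Good.congr (hu : σ u = τ u) (h : ∀ v < I.n, I.adj u v = true → σ v = τ v)
    (hσ : I.Good σ u) : I.Good τ u := by
  have h : ∀ c, I.nb σ (range I.n) c u = I.nb τ (range I.n) c u := fun c =>
    nb_congr fun v hv ha => h v (mem_range.1 hv) ha
  rwa [Good, ← hu, ← h, ← h]

theorem entry_map_range {f : ℕ → Entry} {m : ℕ} (hu : u < I.n) :
    entry (m, (List.range I.n).map f) u = f u := by
  simp [entry, List.getD_eq_getElem?_getD, hu]

theorem entry_profile (hu : u < I.n) : entry (I.profile σ B D) u =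
    if u ∈ B then (σ u, I.nb σ D 1 u, I.nb σ D 2 u) else (0, 0, 0) :=
  entry_map_range hu

theorem cls_profile (hB : B ⊆ range I.n) (hu : u ∈ B) : cls (I.profile σ B D) u = σ u := by
  rw [cls, entry_profile (mem_range.1 (hB hu)), if_pos hu]

theorem profile_congr {m : ℕ} {f : ℕ → Entry} (hm : m = size σ D)
    (hf : ∀ u < I.n, f u = if u ∈ B then (σ u, I.nb σ D 1 u, I.nb σ D 2 u) else (0, 0, 0)) :
    (m, (List.range I.n).map f) = I.profile σ B D :=
  Prod.ext hm (List.map_congr_left fun u hu => hf u (List.mem_range.1 hu))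

theorem profile_cls (hB : B ⊆ range I.n) :
    I.profile (cls (I.profile σ B ∅)) B ∅ = I.profile σ B ∅ := by
  refine profile_congr (size_congr fun v hv => absurd hv (notMem_empty v)) fun u _ => ?_
  split
  · rw [cls_profile hB ‹_›]
    rfl
  · rfl

theorem forget_profile (hD : Disjoint D (I.bagSet s)) :
    I.forget t s (I.profile σ (I.bagSet s) D) =
      I.profile σ (I.bagSet s ∩ I.bagSet t) (D ∪ I.bagSet s \ I.bagSet t) := by
  have hcls : ∀ v ∈ I.bagSet s \ I.bagSet t, cls (I.profile σ (I.bagSet s) D) v = σ v :=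
    fun v hv => cls_profile bagSet_subset (sdiff_subset hv)
  have hD' : Disjoint D (I.bagSet s \ I.bagSet t) := hD.mono_right sdiff_subset
  refine profile_congr ?_ fun u hu => ?_
  · rw [size_union hD', size_congr hcls]
    rfl
  · split
    · have hus := (mem_inter.1 ‹_›).1
      rw [cls, entry_profile hu, if_pos hus, nb_union hD', nb_union hD',
        nb_congr fun v hv _ => hcls v hv, nb_congr fun v hv _ => hcls v hv]
    · rfl

theorem join_profile {ρ : ℕ → ℕ} {B' : Finset ℕ} (hB : B' ⊆ B) (hDE : Disjoint D E)
    (hσ : ∀ v ∈ B ∪ D, ρ v = σ v) (hτ : ∀ v ∈ E, ρ v = τ v)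
    (hE : ∀ u ∈ B \ B', ∀ v ∈ E, I.adj u v = false) :
    join (I.profile σ B D) (I.profile τ B' E) I.n = I.profile ρ B (D ∪ E) := by
  refine profile_congr ?_ fun u hu => ?_
  · rw [size_union hDE, size_congr fun v hv => hσ v (mem_union_right _ hv), size_congr hτ]
    rfl
  · have hnb : ∀ c, I.nb ρ (D ∪ E) c u = I.nb σ D c u + I.nb τ E c u := fun c => by
      rw [nb_union hDE, nb_congr fun v hv _ => hσ v (mem_union_right _ hv),
        nb_congr fun v hv _ => hτ v hv]
    have hE₀ : u ∈ B \ B' → ∀ c, I.nb τ E c u = 0 := fun hu c =>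
      card_eq_zero.2 (filter_eq_empty_iff.2 fun v hv h => by simp [hE u hu v hv] at h)
    rw [cls, entry_profile hu, entry_profile hu]
    by_cases hB' : u ∈ B'
    · simp [hB', hB hB', hnb, hσ u (mem_union_left _ (hB hB'))]
    by_cases hB : u ∈ B
    · simp [hB', hB, hnb, hE₀ (mem_sdiff.2 ⟨hB, hB'⟩), hσ u (mem_union_left _ hB)]
    · simp [hB', hB]

theorem isClosed_profile (hD : Disjoint D (I.bagSet s)) (hDn : D ⊆ range I.n)
    (h : ∀ u ∈ I.bagSet s \ I.bagSet t, ∀ v < I.n, I.adj u v = true → v ∈ D ∪ I.bagSet s) :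
    I.isClosed t s (I.profile σ (I.bagSet s) D) = true ↔
      ∀ u ∈ I.bagSet s \ I.bagSet t, I.Good σ u := by
  rw [isClosed, decide_eq_true_iff]
  refine forall₂_congr fun u hu => ?_
  have hus := sdiff_subset hu
  have hnb : ∀ c, I.nb σ (range I.n) c u = I.nb σ D c u +
      I.nb (cls (I.profile σ (I.bagSet s) D)) (I.bagSet s) c u := fun c => by
    rw [nb_congr (σ := cls _) (τ := σ) fun v hv _ => cls_profile bagSet_subset hv, ← nb_union hD]
    exact nb_subset (union_subset hDn bagSet_subset) fun v hv => h u hu v (mem_range.1 hv)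
  rw [Good, hnb, hnb, cls_profile bagSet_subset hus,
    entry_profile (mem_range.1 (bagSet_subset hus)), if_pos hus]

theorem isCompatible_profile :
    I.isCompatible t s (I.profile σ (I.bagSet t) D) (I.profile τ (I.bagSet s) E) = true ↔
      ∀ u ∈ I.bagSet s ∩ I.bagSet t, σ u = τ u := by
  rw [isCompatible, decide_eq_true_iff]
  refine forall₂_congr fun u hu => ?_
  rw [cls_profile bagSet_subset (mem_inter.1 hu).2, cls_profile bagSet_subset (mem_inter.1 hu).1]

end DecompData

/-! ## Rooted tree decompositions -/

namespace DecompData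

open Finset

/-- The node `s` is equal to the node `t` or one of its descendants. -/
def Desc (I : DecompData) : ℕ → ℕ → Prop :=
  Relation.ReflTransGen fun t s => I.child t s = true

/-- The data describe a tree decomposition of a graph, whose tree is rooted at `I.r`. The
connectivity of the set of all nodes with `v` in their bag says that every cut `S` through this set
is crossed by an edge of the tree inside this set. -/
structure IsDecomposition (I : DecompData) (depth : ℕ → ℕ) : Prop where
  adj_symm : ∀ {u v}, I.adj u v = true → I.adj v u = true
  root_lt : I.r < I.N
  child_lt : ∀ {t s}, I.child t s = true → s < I.N
  depth_lt : ∀ {t}, t < I.N → depth t < I.N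
  depth_child : ∀ {t s}, I.child t s = true → depth s = depth t + 1
  parent_unique : ∀ {t t' s}, I.child t s = true → I.child t' s = true → t = t'
  desc_root : ∀ {t}, t < I.N → I.Desc I.r t
  bag_lt : ∀ {t v}, I.bag t v = true → t < I.N
  vertex_mem : ∀ {v}, v < I.n → ∃ t, I.bag t v = true
  edge_mem : ∀ {u v}, u < I.n → v < I.n → I.adj u v = true →
    ∃ t, I.bag t u = true ∧ I.bag t v = true
  connected : ∀ {v}, v < I.n → ∀ (S : Set ℕ) {x y}, x ∈ S → I.bag x v = true → y ∉ S →
    I.bag y v = true → ∃ a ∈ S, ∃ b ∉ S, I.bag a v = true ∧ I.bag b v = true ∧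
      (I.child a b = true ∨ I.child b a = true)

open Classical in
/-- The vertices that only occur in bags below the node `s`. -/
noncomputable def below (I : DecompData) (s : ℕ) : Finset ℕ :=
  {v ∈ range I.n | ∀ t, I.bag t v = true → I.Desc s t}

/-- The vertices that only occur in bags below one of the children of `t` less than `j`. -/
noncomputable def region (I : DecompData) (t j : ℕ) : Finset ℕ :=
  {s ∈ range j | I.child t s}.biUnion I.below

variable {I : DecompData} {depth σ τ : ℕ → ℕ} {t s s' x y u v j : ℕ}

theorem mem_below : v ∈ I.below s ↔ v < I.n ∧ ∀ t, I.bag t v = true → I.Desc s t := by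
  simp [below]

theorem mem_region : v ∈ I.region t j ↔ ∃ s < j, I.child t s = true ∧ v ∈ I.below s := by
  simp [region, and_assoc]

theorem below_subset : I.below s ⊆ range I.n := fun _ hv => mem_range.2 (mem_below.1 hv).1

theorem region_subset : I.region t j ⊆ range I.n := biUnion_subset.2 fun _ _ => below_subset

theorem region_succ : I.region t (j + 1) =
    if I.child t j then I.region t j ∪ I.below j else I.region t j := by
  rw [region, range_add_one, filter_insert]
  split
  · rw [biUnion_insert, union_comm, region]
  · rfl

namespace IsDecomposition

variable (hI : I.IsDecomposition depth)
include hI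

theorem eq_or_depth_lt (h : I.Desc t s) : t = s ∨ depth t < depth s := by
  induction h with
  | refl => exact .inl rfl
  | tail _ hc ih =>
    rw [hI.depth_child hc]
    exact .inr (Nat.lt_succ_of_le (ih.elim (fun h => (congrArg depth h).le) Nat.le_of_lt))

theorem not_desc_parent (hc : I.child t s = true) : ¬ I.Desc s t := fun h => by
  have := hI.depth_child hc
  rcases hI.eq_or_depth_lt h with rfl | h <;> omega

theorem desc_parent (hc : I.child t x = true) (h : I.Desc s x) (hs : s ≠ x) : I.Desc s t := by
  obtain rfl | ⟨y, hy, hyx⟩ := Relation.ReflTransGen.cases_tail h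
  · exact (hs rfl).elim
  · rwa [hI.parent_unique hc hyx]

theorem not_desc_of_ne (hs : I.child t s = true) (hs' : I.child t s' = true) (hne : s ≠ s')
    (h : I.Desc s x) : ¬ I.Desc s' x := by
  induction h with
  | refl => exact fun h' => hI.not_desc_parent hs' (hI.desc_parent hs h' hne.symm)
  | @tail y x hy hyx ih =>
    intro h'
    refine ih (hI.desc_parent hyx h' ?_)
    rintro rfl
    exact hI.not_desc_parent hs (hI.parent_unique hyx hs' ▸ hy)

theorem bag_of_desc_of_not_desc (hc : I.child t s = true) (hv : v < I.n) (hx : I.Desc s x)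
    (hxv : I.bag x v = true) (hy : ¬ I.Desc s y) (hyv : I.bag y v = true) :
    I.bag s v = true ∧ I.bag t v = true := by
  obtain ⟨a, ha, b, hb, hav, hbv, hab | hba⟩ := hI.connected hv {x | I.Desc s x} hx hxv hy hyv
  · exact (hb (ha.tail hab)).elim
  · obtain rfl : s = a := by_contra fun h => hb (hI.desc_parent hba ha h)
    exact ⟨hav, hI.parent_unique hba hc ▸ hbv⟩

theorem below_sdiff_bagSet : I.below s \ I.bagSet s = I.region s I.N := by
  ext v
  simp only [mem_sdiff, mem_below, mem_region, mem_bagSet]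
  constructor
  · rintro ⟨⟨hv, hs⟩, hsv⟩
    obtain ⟨x, hx⟩ := hI.vertex_mem hv
    obtain rfl | ⟨c, hc, hcx⟩ := Relation.ReflTransGen.cases_head (hs x hx)
    · exact (hsv ⟨hv, hx⟩).elim
    · refine ⟨c, hI.child_lt hc, hc, hv, fun y hy => by_contra fun hcy => ?_⟩
      exact hsv ⟨hv, (hI.bag_of_desc_of_not_desc hc hv hcx hx hcy hy).2⟩
  · rintro ⟨c, -, hc, hv, h⟩
    exact ⟨⟨hv, fun y hy => (h y hy).head hc⟩, fun hs => hI.not_desc_parent hc (h s hs.2)⟩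

theorem disjoint_below_bagSet (hc : I.child t s = true) : Disjoint (I.below s) (I.bagSet t) :=
  Finset.disjoint_left.2 fun _ hv ht =>
    hI.not_desc_parent hc ((mem_below.1 hv).2 t (mem_bagSet.1 ht).2)

theorem disjoint_region_bagSet : Disjoint (I.region t j) (I.bagSet t) :=
  (disjoint_biUnion_left ..).2 fun _ hs => hI.disjoint_below_bagSet (mem_filter.1 hs).2

theorem bagSet_sdiff_subset_below (hc : I.child t s = true) :
    I.bagSet s \ I.bagSet t ⊆ I.below s := fun v hv => by
  obtain ⟨hs, ht⟩ := mem_sdiff.1 hv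
  obtain ⟨hv, hs⟩ := mem_bagSet.1 hs
  refine mem_below.2 ⟨hv, fun y hy => by_contra fun hsy => ht (mem_bagSet.2 ⟨hv, ?_⟩)⟩
  exact (hI.bag_of_desc_of_not_desc hc hv .refl hs hsy hy).2

theorem below_eq (hc : I.child t s = true) :
    I.below s = I.region s I.N ∪ I.bagSet s \ I.bagSet t := by
  rw [← hI.below_sdiff_bagSet]
  refine Subset.antisymm (fun v hv => ?_)
    (union_subset sdiff_subset (hI.bagSet_sdiff_subset_below hc))
  by_cases hs : v ∈ I.bagSet s
  · refine mem_union_right _ (mem_sdiff.2 ⟨hs, ?_⟩)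
    exact Finset.disjoint_left.1 (hI.disjoint_below_bagSet hc) hv
  · exact mem_union_left _ (mem_sdiff.2 ⟨hv, hs⟩)

theorem below_root : I.below I.r = range I.n :=
  Subset.antisymm below_subset fun _ hv =>
    mem_below.2 ⟨mem_range.1 hv, fun _ ht => hI.desc_root (hI.bag_lt ht)⟩

theorem bagSet_N : I.bagSet I.N = ∅ :=
  eq_empty_of_forall_notMem fun _ hv => (hI.bag_lt (mem_bagSet.1 hv).2).false

theorem region_root_union : I.region I.r I.N ∪ I.bagSet I.r \ I.bagSet I.N = range I.n := by
  rw [← hI.below_sdiff_bagSet, hI.below_root, hI.bagSet_N, sdiff_empty,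
    sdiff_union_of_subset bagSet_subset]

theorem mem_below_or_bagSet (hs : s < I.N) (hv : v ∈ I.below s) (hu : u < I.n)
    (huv : I.adj v u = true) : u ∈ I.below s ∪ I.bagSet s := by
  obtain ⟨hvn, hv⟩ := mem_below.1 hv
  obtain ⟨x, hxv, hxu⟩ := hI.edge_mem hvn hu huv
  by_cases h : ∀ y, I.bag y u = true → I.Desc s y
  · exact mem_union_left _ (mem_below.2 ⟨hu, h⟩)
  push Not at h
  obtain ⟨y, hyu, hsy⟩ := h
  obtain rfl | ⟨t, -, hc⟩ := Relation.ReflTransGen.cases_tail (hI.desc_root hs)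
  · exact (hsy (hI.desc_root (hI.bag_lt hyu))).elim
  · exact mem_union_right _ (mem_bagSet.2
      ⟨hu, (hI.bag_of_desc_of_not_desc hc hu (hv x hxv) hxu hsy hyu).1⟩)

theorem adj_eq_false_of_mem_bagSet (hc : I.child t s = true)
    (hu : u ∈ I.bagSet t \ (I.bagSet s ∩ I.bagSet t)) (hv : v ∈ I.below s) :
    I.adj u v = false := by
  obtain ⟨ht, hs⟩ := mem_sdiff.1 hu
  refine Bool.eq_false_iff.2 fun huv => hs (mem_inter.2 ⟨?_, ht⟩)
  refine (mem_union.1 (hI.mem_below_or_bagSet (hI.child_lt hc) hv (mem_bagSet.1 ht).1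
    (hI.adj_symm huv))).resolve_left fun h => ?_
  exact Finset.disjoint_left.1 (hI.disjoint_below_bagSet hc) h ht

theorem disjoint_region_below (hc : I.child t j = true) :
    Disjoint (I.region t j) (I.below j) := by
  refine Finset.disjoint_left.2 fun v hv hj => ?_
  obtain ⟨s, hs, hts, hv⟩ := mem_region.1 hv
  obtain ⟨x, hx⟩ := hI.vertex_mem (mem_below.1 hv).1
  exact hI.not_desc_of_ne hts hc hs.ne ((mem_below.1 hv).2 x hx) ((mem_below.1 hj).2 x hx)

theorem adj_eq_false_of_mem_region (hc : I.child t j = true) (hu : u ∈ I.region t j)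
    (hv : v ∈ I.below j) : I.adj u v = false := by
  refine Bool.eq_false_iff.2 fun huv => ?_
  have hn := mem_range.1 (region_subset hu)
  rcases mem_union.1 (hI.mem_below_or_bagSet (hI.child_lt hc) hv hn (hI.adj_symm huv)) with h | h
  · exact Finset.disjoint_left.1 (hI.disjoint_region_below hc) hu h
  · obtain ⟨s, hs, hts, hu⟩ := mem_region.1 hu
    exact hI.not_desc_of_ne hc hts hs.ne' .refl ((mem_below.1 hu).2 j (mem_bagSet.1 h).2)

/-! ## Correctness of the dynamic program -/

theorem isClosed_profile_region (hs : s < I.N) (ht : I.bagSet s \ I.bagSet t ⊆ I.below s) :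
    I.isClosed t s (I.profile σ (I.bagSet s) (I.region s I.N)) = true ↔
      ∀ u ∈ I.bagSet s \ I.bagSet t, I.Good σ u :=
  isClosed_profile hI.disjoint_region_bagSet region_subset fun u hu v hv huv => by
    rw [← hI.below_sdiff_bagSet, sdiff_union_self_eq_union]
    exact hI.mem_below_or_bagSet hs (ht hu) hv huv

theorem forget_profile_region (hc : I.child t s = true) :
    I.forget t s (I.profile σ (I.bagSet s) (I.region s I.N)) =
      I.profile σ (I.bagSet s ∩ I.bagSet t) (I.below s) := by
  rw [forget_profile hI.disjoint_region_bagSet, ← hI.below_eq hc]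

theorem join_profile_region (hc : I.child t j = true) {ρ : ℕ → ℕ}
    (hσ : ∀ v ∉ I.below j, ρ v = σ v) (hτ : ∀ v ∈ I.below j, ρ v = τ v) :
    join (I.profile σ (I.bagSet t) (I.region t j))
        (I.forget t j (I.profile τ (I.bagSet j) (I.region j I.N))) I.n =
      I.profile ρ (I.bagSet t) (I.region t j ∪ I.below j) := by
  rw [hI.forget_profile_region hc]
  have hdisj : Disjoint (I.bagSet t ∪ I.region t j) (I.below j) :=
    disjoint_union_left.2 ⟨(hI.disjoint_below_bagSet hc).symm, hI.disjoint_region_below hc⟩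
  exact join_profile inter_subset_right (hI.disjoint_region_below hc)
    (fun v hv => hσ v (Finset.disjoint_left.1 hdisj hv)) hτ
    fun u hu v hv => hI.adj_eq_false_of_mem_bagSet hc hu hv

theorem good_glue (hc : I.child t j = true) {ρ : ℕ → ℕ}
    (hστ : ∀ v ∈ I.bagSet j ∩ I.bagSet t, σ v = τ v)
    (hσ : ∀ v ∉ I.below j, ρ v = σ v) (hτ : ∀ v ∈ I.below j, ρ v = τ v)
    (hgσ : ∀ u ∈ I.region t j, I.Good σ u) (hgτ : ∀ u ∈ I.below j, I.Good τ u) :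
    ∀ u ∈ I.region t j ∪ I.below j, I.Good ρ u := fun u hu => by
  rcases mem_union.1 hu with hu | hu
  · refine (hgσ u hu).congr (hσ u ?_).symm fun v _ huv => (hσ v fun hv => ?_).symm
    · exact Finset.disjoint_left.1 (hI.disjoint_region_below hc) hu
    · exact Bool.false_ne_true ((hI.adj_eq_false_of_mem_region hc hu hv).symm.trans huv)
  · refine (hgτ u hu).congr (hτ u hu).symm fun v hvn huv => ?_
    by_cases hv : v ∈ I.below j
    · exact (hτ v hv).symm
    have hj : v ∈ I.bagSet j :=
      (mem_union.1 (hI.mem_below_or_bagSet (hI.child_lt hc) hu hvn huv)).resolve_left hv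
    have ht : v ∈ I.bagSet t := by_contra fun ht =>
      hv (hI.bagSet_sdiff_subset_below hc (mem_sdiff.2 ⟨hj, ht⟩))
    rw [hσ v hv, hστ v (mem_inter.2 ⟨hj, ht⟩)]

end IsDecomposition

theorem table_succ (i : ℕ) :
    I.table (i + 1) = I.candidates.filter (I.follows (I.table i)) :=
  Function.iterate_succ_apply' ..

theorem mem_candidates {p : Profile} : (t, j, p) ∈ I.candidates ↔
    t < I.N ∧ j ≤ I.N ∧ p.1 ≤ I.n ∧ p.2 ∈ I.states t := by
  obtain ⟨m, l⟩ := p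
  simp only [candidates, List.mem_flatMap, List.mem_range, List.mem_product, List.mem_singleton,
    Nat.lt_succ_iff]
  constructor
  · rintro ⟨t, ht, rfl, hp⟩
    exact ⟨ht, hp⟩
  · exact fun ⟨ht, hp⟩ => ⟨t, ht, rfl, hp⟩

theorem profile_mem_states {D : Finset ℕ} (hσ : ∀ v, σ v ≤ 2) (hD : D ⊆ range I.n) :
    (I.profile σ (I.bagSet t) D).2 ∈ I.states t := by
  rw [states, List.mem_sections, profile, List.forall₂_map_left_iff, List.forall₂_map_right_iff,
    List.forall₂_same]
  intro v hv
  rw [options]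
  split <;> rename_i hb
  · simp only [if_pos (mem_bagSet.2 ⟨List.mem_range.1 hv, hb⟩), List.mem_product, List.mem_range]
    exact ⟨Nat.lt_succ_of_le (hσ v), Nat.lt_succ_of_le (nb_le hD), Nat.lt_succ_of_le (nb_le hD)⟩
  · rw [if_neg fun h => hb (mem_bagSet.1 h).2, List.mem_singleton]

theorem profile_mem_candidates (hσ : ∀ v, σ v ≤ 2) (ht : t < I.N) (hj : j ≤ I.N) :
    (t, j, I.profile σ (I.bagSet t) (I.region t j)) ∈ I.candidates :=
  mem_candidates.2 ⟨ht, hj, size_le region_subset, profile_mem_states hσ region_subset⟩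

theorem follows_zero {T : List Record} {p : Profile} :
    I.follows T (t, 0, p) = true ↔ p = I.profile (cls p) (I.bagSet t) ∅ := by
  rw [follows, decide_eq_true_iff]

theorem follows_succ {T : List Record} {p : Profile} : I.follows T (t, j + 1, p) = true ↔
    if I.child t j then
      ∃ f, (t, j, f) ∈ T ∧ ∃ g, (j, I.N, g) ∈ T ∧ I.isClosed t j g = true ∧
        I.isCompatible t j f g = true ∧ p = join f (I.forget t j g) I.n
    else (t, j, p) ∈ T := by
  rw [follows]
  split
  · simp only [isStepFrom, isStep, List.any_eq_true, Bool.and_eq_true, decide_eq_true_iff]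
    constructor
    · rintro ⟨⟨_, _, f⟩, hf, ⟨rfl, rfl⟩, ⟨_, _, g⟩, hg, ⟨rfl, rfl⟩, ⟨hcl, hco⟩, hp⟩
      exact ⟨f, hf, g, hg, hcl, hco, hp⟩
    · rintro ⟨f, hf, g, hg, hcl, hco, hp⟩
      exact ⟨_, hf, ⟨rfl, rfl⟩, _, hg, ⟨rfl, rfl⟩, ⟨hcl, hco⟩, hp⟩
  · rw [decide_eq_true_iff]

namespace IsDecomposition

variable (hI : I.IsDecomposition depth)
include hI

theorem exists_of_mem_table {i : ℕ} {p : Profile} (h : (t, j, p) ∈ I.table i) :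
    ∃ σ, p = I.profile σ (I.bagSet t) (I.region t j) ∧ ∀ u ∈ I.region t j, I.Good σ u := by
  induction i generalizing t j p with
  | zero => exact absurd h List.not_mem_nil
  | succ i ih =>
    rw [table_succ] at h
    have h := (List.mem_filter.1 h).2
    cases j with
    | zero => exact ⟨cls p, follows_zero.1 h, fun u hu => absurd hu (notMem_empty u)⟩
    | succ j =>
      rw [follows_succ] at h
      rw [region_succ]
      split at h <;> rename_i hc
      · obtain ⟨f, hf, g, hg, hcl, hco, rfl⟩ := h
        obtain ⟨σ, rfl, hσ⟩ := ih hf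
        obtain ⟨τ, rfl, hτ⟩ := ih hg
        rw [isCompatible_profile] at hco
        rw [hI.isClosed_profile_region (hI.child_lt hc) (hI.bagSet_sdiff_subset_below hc)] at hcl
        have hgτ : ∀ u ∈ I.below j, I.Good τ u := by
          rw [hI.below_eq hc]
          exact fun u hu => (mem_union.1 hu).elim (hτ u) (hcl u)
        rw [if_pos hc]
        classical
        exact ⟨fun v => if v ∈ I.below j then τ v else σ v,
          hI.join_profile_region hc (fun _ hv => if_neg hv) fun _ hv => if_pos hv,
          hI.good_glue hc hco (fun _ hv => if_neg hv) (fun _ hv => if_pos hv) hσ hgτ⟩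
      · rw [if_neg hc]
        exact ih h

/-- A record for the node `t` is derived after the records for all deeper nodes, each of which takes
at most `N + 1` rounds. -/
theorem mem_table (hσ : ∀ v, σ v ≤ 2) {i : ℕ} (ht : t < I.N) (hj : j ≤ I.N)
    (hi : (I.N - 1 - depth t) * (I.N + 1) + j + 1 ≤ i) (hg : ∀ u ∈ I.region t j, I.Good σ u) :
    (t, j, I.profile σ (I.bagSet t) (I.region t j)) ∈ I.table i := by
  induction i generalizing t j with
  | zero => omega
  | succ i ih =>
    rw [table_succ]
    refine List.mem_filter.2 ⟨profile_mem_candidates hσ ht hj, ?_⟩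
    cases j with
    | zero => exact follows_zero.2 (profile_cls bagSet_subset).symm
    | succ j =>
      rw [follows_succ]
      rw [region_succ] at hg ⊢
      split at hg <;> rename_i hc
      · rw [if_pos hc, if_pos hc]
        have hgj : ∀ u ∈ I.region j I.N ∪ I.bagSet j \ I.bagSet t, I.Good σ u := fun u hu =>
          hg u (mem_union_right _ (hI.below_eq hc ▸ hu))
        have hij : (I.N - 1 - depth j) * (I.N + 1) + I.N + 1 ≤ i := by
          have := hI.depth_lt (hI.child_lt hc)
          have h : I.N - 1 - depth t = I.N - 1 - depth j + 1 := by
            have := hI.depth_child hc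
            omega
          rw [h, Nat.succ_mul] at hi
          omega
        refine ⟨_, ih ht (by omega) (by omega) fun u hu => hg u (mem_union_left _ hu), _,
          ih (hI.child_lt hc) le_rfl hij fun u hu => hgj u (mem_union_left _ hu), ?_,
          isCompatible_profile.2 fun _ _ => rfl,
          (hI.join_profile_region hc (fun _ _ => rfl) fun _ _ => rfl).symm⟩
        exact (hI.isClosed_profile_region (hI.child_lt hc) (hI.bagSet_sdiff_subset_below hc)).2
          fun u hu => hgj u (mem_union_right _ hu)
      · rw [if_neg hc, if_neg hc]
        exact ih ht (by omega) (by omega) hg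

theorem isClosed_root : I.isClosed I.N I.r (I.profile σ (I.bagSet I.r) (I.region I.r I.N)) = true ↔
    ∀ u ∈ I.bagSet I.r \ I.bagSet I.N, I.Good σ u :=
  hI.isClosed_profile_region hI.root_lt (by
    rw [hI.below_root]
    exact sdiff_subset.trans bagSet_subset)

theorem forget_root :
    (I.forget I.N I.r (I.profile σ (I.bagSet I.r) (I.region I.r I.N))).1 = size σ (range I.n) := by
  rw [forget_profile hI.disjoint_region_bagSet, hI.region_root_union, profile]

theorem size_le_answer (hσ : ∀ v, σ v ≤ 2) (hg : ∀ v < I.n, I.Good σ v) :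
    size σ (range I.n) ≤ I.answer := by
  have hg : ∀ u ∈ range I.n, I.Good σ u := fun u hu => hg u (mem_range.1 hu)
  have hi : (I.N - 1 - depth I.r) * (I.N + 1) + I.N + 1 ≤ I.N * (I.N + 1) := by
    obtain ⟨m, hm⟩ := Nat.exists_eq_add_of_lt hI.root_lt
    rw [add_assoc, ← Nat.succ_mul]
    exact Nat.mul_le_mul_right _ (by omega)
  refine (foldl_max_spec _ _).2 _ (List.mem_cons_of_mem _ (List.mem_map.2
    ⟨_, List.mem_filter.2 ⟨hI.mem_table hσ hI.root_lt le_rfl hi fun u hu =>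
      hg u (region_subset hu), ?_⟩, hI.forget_root⟩))
  simp only [decide_true, Bool.true_and, and_self]
  exact hI.isClosed_root.2 fun u hu => hg u (bagSet_subset (sdiff_subset hu))

theorem exists_of_answer_ne_one (h : I.answer ≠ 1) :
    ∃ σ, (∀ v < I.n, I.Good σ v) ∧ size σ (range I.n) = I.answer := by
  have hmem := (List.mem_cons.1 (foldl_max_spec _ _).1).resolve_left h
  obtain ⟨⟨t, j, p⟩, hx, ha⟩ := List.mem_map.1 hmem
  simp only [List.mem_filter, Bool.and_eq_true, decide_eq_true_iff] at hx
  obtain ⟨hx, ⟨rfl, rfl⟩, hcl⟩ := hx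
  obtain ⟨σ, rfl, hg⟩ := hI.exists_of_mem_table hx
  refine ⟨σ, fun v hv => ?_, hI.forget_root.symm.trans ha⟩
  have hv := mem_range.2 hv
  rw [← hI.region_root_union] at hv
  exact (mem_union.1 hv).elim (hg v) (hI.isClosed_root.1 hcl v)

end IsDecomposition

theorem one_le_answer : 1 ≤ I.answer := (foldl_max_spec _ _).2 _ List.mem_cons_self

end DecompData

/-! ## From the input word to the decomposition -/

section RootedTree

variable {ι : Type*} {T : SimpleGraph ι} {r s s' t : ι}

theorem exists_isChild (hT : T.Connected) (ht : t ≠ r) : ∃ s, IsChild T r s t := by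
  obtain ⟨w, hw⟩ := hT.exists_walk_length_eq_dist t r
  cases w with
  | nil => exact (ht rfl).elim
  | @cons _ s _ h w =>
    refine ⟨s, h.symm, ?_⟩
    have hs := SimpleGraph.dist_le w
    have hts := hT.dist_triangle (u := t) (v := s) (w := r)
    rw [SimpleGraph.dist_eq_one_iff_adj.2 h] at hts
    rw [SimpleGraph.Walk.length_cons] at hw
    rw [SimpleGraph.dist_comm, SimpleGraph.dist_comm (u := r)]
    omega

theorem IsChild.parent_unique (hT : T.IsTree) (h : IsChild T r s t) (h' : IsChild T r s' t) :
    s = s' := by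
  have exists_isPath : ∀ {s}, (h : IsChild T r s t) →
      ∃ w : T.Walk s r, (SimpleGraph.Walk.cons h.1.symm w).IsPath := fun {s} h => by
    obtain ⟨w, hw⟩ := hT.connected.exists_walk_length_eq_dist s r
    refine ⟨w, SimpleGraph.Walk.isPath_of_length_eq_dist _ ?_⟩
    rw [SimpleGraph.Walk.length_cons, hw, SimpleGraph.dist_comm, SimpleGraph.dist_comm (u := t),
      h.2]
  obtain ⟨w, hw⟩ := exists_isPath h
  obtain ⟨w', hw'⟩ := exists_isPath h'
  simpa using congrArg SimpleGraph.Walk.snd ((hT.existsUnique_path t r).unique hw hw')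

theorem reflTransGen_isChild (hT : T.Connected) (t : ι) :
    Relation.ReflTransGen (IsChild T r) r t := by
  induction hd : T.dist r t generalizing t with
  | zero => rw [hT.dist_eq_zero_iff.1 hd]
  | succ k ih =>
    obtain ⟨s, hs⟩ := exists_isChild hT (r := r) (t := t) fun h => by simp [h] at hd
    exact (ih s (Nat.succ_injective (hs.2.symm.trans hd))).tail hs

theorem dist_lt_card [Fintype ι] (hT : T.Connected) : T.dist s t < Fintype.card ι := by
  obtain ⟨w, hw, hl⟩ := hT.exists_path_of_dist s t
  exact hl ▸ hw.length_lt

theorem IsTreeDecomposition.exists_isChild_of_mem_of_notMem {V : Type*} {G : SimpleGraph V}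
    {X : ι → Finset V} (hX : IsTreeDecomposition G T X) (r : ι) {v : V} {S : Set ι} {x y : ι}
    (hx : x ∈ S) (hxv : v ∈ X x) (hy : y ∉ S) (hyv : v ∈ X y) :
    ∃ a ∈ S, ∃ b ∉ S, v ∈ X a ∧ v ∈ X b ∧ (IsChild T r a b ∨ IsChild T r b a) := by
  obtain ⟨w⟩ := (hX.connected v).preconnected ⟨x, hxv⟩ ⟨y, hyv⟩
  obtain ⟨d, -, ha, hb⟩ := w.exists_boundary_dart (Subtype.val ⁻¹' S) hx hy
  have hadj : T.Adj d.fst d.snd := d.adj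
  refine ⟨_, ha, _, hb, d.fst.2, d.snd.2, ?_⟩
  exact (hX.isTree.dist_eq_dist_add_one_of_adj r hadj).symm.imp
    (fun h => ⟨hadj, h⟩) fun h => ⟨hadj.symm, h⟩

end RootedTree

/-- The relation on the numbers below `m` and `n` whose matrix stands at position `o` of the
word `w`. -/
def relationAt (w : List ℕ) (o m n i j : ℕ) : Bool :=
  decide (i + 1 ≤ m) && decide (j + 1 ≤ n) && decide (w.getD (o + (j + n * i)) 0 = 1)

/-- The graph and the tree decomposition that are described by an input word. -/
def DecompData.ofWord (w : List ℕ) : DecompData where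
  n := w.getD 0 0
  N := w.getD 1 0
  r := w.getD 2 0
  adj := relationAt w 3 (w.getD 0 0) (w.getD 0 0)
  child := relationAt w (3 + w.getD 0 0 * w.getD 0 0) (w.getD 1 0) (w.getD 1 0)
  bag := relationAt w (3 + w.getD 0 0 * w.getD 0 0 + w.getD 1 0 * w.getD 1 0) (w.getD 1 0)
    (w.getD 0 0)

section InputWord

theorem length_relationMatrix {m n : ℕ} (R : Fin m → Fin n → Prop) :
    (relationMatrix R).length = m * n := by simp [relationMatrix]

theorem le_one_of_mem_relationMatrix {m n a : ℕ} {R : Fin m → Fin n → Prop}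
    (h : a ∈ relationMatrix R) : a ≤ 1 := by
  obtain ⟨p, rfl⟩ := (List.mem_ofFn' _ _).1 h
  dsimp only
  split <;> decide

open Classical in
theorem getD_relationMatrix {m n : ℕ} (R : Fin m → Fin n → Prop) (i : Fin m) (j : Fin n) :
    (relationMatrix R).getD (j + n * i) 0 = if R i j then 1 else 0 := by
  have hk : finProdFinEquiv (i, j) < m * n := (finProdFinEquiv (i, j)).2
  obtain ⟨hi, hj⟩ := Prod.ext_iff.1 (finProdFinEquiv.symm_apply_apply (i, j))
  have hlen : finProdFinEquiv (i, j) < (relationMatrix R).length := by rwa [length_relationMatrix]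
  refine (List.getD_eq_getElem _ _ hlen).trans ((List.getElem_ofFn _).trans ?_)
  exact congrArg₂ (fun i j => if R i j then 1 else 0) hi hj

theorem relationAt_append {m n o : ℕ} {l l' : List ℕ} (hl : l.length = o)
    (R : Fin m → Fin n → Prop) {i j : ℕ} :
    relationAt (l ++ relationMatrix R ++ l') o m n i j = true ↔
      Relation.Map R Fin.val Fin.val i j := by
  have getD_eq_one_iff : ∀ (i : Fin m) (j : Fin n),
      (l ++ relationMatrix R ++ l').getD (o + (j + n * i)) 0 = 1 ↔ R i j := fun i j => by
    have hk : (j : ℕ) + n * i < (relationMatrix R).length :=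
      (finProdFinEquiv (i, j)).2.trans_eq (length_relationMatrix R).symm
    rw [List.append_assoc, List.getD_append_right _ _ _ _ (by omega), ← hl,
      Nat.add_sub_cancel_left, List.getD_append _ _ _ _ hk, getD_relationMatrix]
    simp
  simp only [relationAt, Bool.and_eq_true, decide_eq_true_eq, Nat.succ_le_iff]
  constructor
  · rintro ⟨⟨hi, hj⟩, h⟩
    exact ⟨⟨i, hi⟩, ⟨j, hj⟩, (getD_eq_one_iff ⟨i, hi⟩ ⟨j, hj⟩).1 h, rfl, rfl⟩
  · rintro ⟨i, j, h, rfl, rfl⟩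
    exact ⟨⟨i.2, j.2⟩, (getD_eq_one_iff i j).2 h⟩

variable {n N : ℕ} {G : SimpleGraph (Fin n)} {T : SimpleGraph (Fin N)} {r : Fin N}
  {X : Fin N → Finset (Fin n)}

theorem length_inputWord : (inputWord G T r X).length = 3 + n * n + N * N + N * n := by
  simp only [inputWord, List.length_append, length_relationMatrix]
  rfl

namespace DecompData

variable (G T r X) in
/-- The data that the input word for a graph with a tree decomposition describes. -/
noncomputable def ofGraph : DecompData := ofWord (inputWord G T r X)

theorem adj_ofGraph {u v : ℕ} : (ofGraph G T r X).adj u v = true ↔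
    Relation.Map G.Adj Fin.val Fin.val u v := by
  rw [ofGraph, inputWord, List.append_assoc]
  exact relationAt_append (l := [n, N, (r : ℕ)]) rfl G.Adj

theorem child_ofGraph {t s : ℕ} : (ofGraph G T r X).child t s = true ↔
    Relation.Map (IsChild T r) Fin.val Fin.val t s := by
  refine relationAt_append ?_ (IsChild T r)
  rw [List.length_append, length_relationMatrix]
  rfl

theorem bag_ofGraph {t v : ℕ} : (ofGraph G T r X).bag t v = true ↔
    Relation.Map (fun t v => v ∈ X t) Fin.val Fin.val t v := by
  rw [ofGraph, inputWord, ← List.append_nil (_ ++ _)]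
  refine relationAt_append ?_ fun t v => v ∈ X t
  simp only [List.length_append, length_relationMatrix]
  rfl

theorem child_of_isChild {t s : Fin N} (h : IsChild T r t s) :
    (ofGraph G T r X).child t s = true :=
  child_ofGraph.2 ⟨_, _, h, rfl, rfl⟩

theorem bag_of_mem {t : Fin N} {v : Fin n} (h : v ∈ X t) : (ofGraph G T r X).bag t v = true :=
  bag_ofGraph.2 ⟨_, _, h, rfl, rfl⟩

theorem exists_isChild_of_bag (hX : IsTreeDecomposition G T X) {v : ℕ} (S : Set ℕ) {x y : ℕ}
    (hx : x ∈ S) (hxv : (ofGraph G T r X).bag x v = true)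
    (hy : y ∉ S) (hyv : (ofGraph G T r X).bag y v = true) :
    ∃ a ∈ S, ∃ b ∉ S, (ofGraph G T r X).bag a v = true ∧ (ofGraph G T r X).bag b v = true ∧
      ((ofGraph G T r X).child a b = true ∨ (ofGraph G T r X).child b a = true) := by
  obtain ⟨x, v, hvx, rfl, rfl⟩ := bag_ofGraph.1 hxv
  obtain ⟨y, v', hvy, rfl, hv⟩ := bag_ofGraph.1 hyv
  obtain ⟨a, ha, b, hb, hav, hbv, hab⟩ := hX.exists_isChild_of_mem_of_notMem r
    (S := Fin.val ⁻¹' S) hx hvx hy (Fin.val_injective hv ▸ hvy)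
  exact ⟨a, ha, b, hb, bag_of_mem hav, bag_of_mem hbv, hab.imp child_of_isChild child_of_isChild⟩

theorem isDecomposition_ofGraph (hX : IsTreeDecomposition G T X) :
    (ofGraph G T r X).IsDecomposition (Function.extend Fin.val (T.dist r) 0) := by
  have hconn := hX.isTree.connected
  have hdepth : ∀ t : Fin N, Function.extend Fin.val (T.dist r) 0 (t : ℕ) = T.dist r t :=
    Fin.val_injective.extend_apply _ _
  refine ⟨fun h => ?_, r.2, fun h => ?_, fun {t} ht => ?_, fun h => ?_, fun h h' => ?_,
    fun {t} ht => ?_, fun h => ?_, fun {v} hv => ?_, fun {u v} hu hv h => ?_,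
    fun _ S _ _ hx hxv hy hyv => exists_isChild_of_bag hX S hx hxv hy hyv⟩
  · obtain ⟨u, v, huv, rfl, rfl⟩ := adj_ofGraph.1 h
    exact adj_ofGraph.2 ⟨v, u, huv.symm, rfl, rfl⟩
  · obtain ⟨t, s, -, rfl, rfl⟩ := child_ofGraph.1 h
    exact s.2
  · exact (hdepth ⟨t, ht⟩).trans_lt ((dist_lt_card hconn).trans_eq (Fintype.card_fin N))
  · obtain ⟨t, s, hts, rfl, rfl⟩ := child_ofGraph.1 h
    rw [hdepth, hdepth, hts.2]
  · obtain ⟨t, s, hts, rfl, rfl⟩ := child_ofGraph.1 h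
    obtain ⟨t', s', hts', rfl, hs⟩ := child_ofGraph.1 h'
    rw [Fin.val_injective hs] at hts'
    rw [hts.parent_unique hX.isTree hts']
  · exact (reflTransGen_isChild hconn (⟨t, ht⟩ : Fin N)).lift Fin.val fun _ _ => child_of_isChild
  · obtain ⟨t, v, -, rfl, rfl⟩ := bag_ofGraph.1 h
    exact t.2
  · obtain ⟨t, ht⟩ := hX.vertex_mem ⟨v, hv⟩
    exact ⟨t, bag_of_mem ht⟩
  · obtain ⟨u, v, huv, rfl, rfl⟩ := adj_ofGraph.1 h
    obtain ⟨t, hut, hvt⟩ := hX.edge_mem u v huv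
    exact ⟨t, bag_of_mem hut, bag_of_mem hvt⟩

end DecompData

end InputWord

/-! ## The running time of the dynamic program -/

/-- The sets `D a` can be listed in time polynomial in `a`. -/
def PolySet {α : Type} [Code α] (D : α → Finset ℕ) : Prop :=
  ∃ l : α → List ℕ, PolyTime l ∧ ∀ a, (l a : Multiset ℕ) = (D a).val

namespace PolySet

variable {α β : Type} [Code α] [Code β] {D E : α → Finset ℕ} {P : α → ℕ → Prop}
  [∀ a, DecidablePred (P a)]

theorem comp {f : β → α} (hD : PolySet D) (hf : PolyTime f) : PolySet fun b => D (f b) :=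
  let ⟨_, hl, hlD⟩ := hD
  ⟨_, hl.comp hf, fun b => hlD (f b)⟩

theorem empty : PolySet fun _ : α => ∅ := ⟨_, .nil, fun _ => rfl⟩

theorem range {m : α → ℕ} (hm : PolyTime m) : PolySet fun a => Finset.range (m a) :=
  ⟨_, hm.range, fun _ => rfl⟩

theorem filter (hD : PolySet D) (hP : PolyTime fun x : α × ℕ => decide (P x.1 x.2)) :
    PolySet fun a => {v ∈ D a | P a v} :=
  let ⟨_, hl, hlD⟩ := hD
  ⟨_, hl.filter hP, fun a => by rw [Finset.filter_val, ← hlD, Multiset.filter_coe]⟩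

theorem card (hD : PolySet D) : PolyTime fun a => (D a).card :=
  let ⟨_, hl, hlD⟩ := hD
  hl.length.congr fun a => by rw [Finset.card, ← hlD, Multiset.coe_card]

theorem forall_mem (hD : PolySet D) (hP : PolyTime fun x : α × ℕ => decide (P x.1 x.2)) :
    PolyTime fun a => decide (∀ v ∈ D a, P a v) :=
  let ⟨_, hl, hlD⟩ := hD
  (hl.all (p := fun a v => decide (P a v)) hP).congr fun a => by
    rw [Bool.eq_iff_iff]
    simp [← Finset.mem_val, ← hlD]

theorem mem {f : α → ℕ} (hD : PolySet D) (hf : PolyTime f) :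
    PolyTime fun a => decide (f a ∈ D a) :=
  let ⟨_, hl, hlD⟩ := hD
  (hf.decide_mem hl).congr fun a => decide_eq_decide.2 <| by
    rw [← Finset.mem_val, ← hlD, Multiset.mem_coe]

theorem inter (hD : PolySet D) (hE : PolySet E) : PolySet fun a => D a ∩ E a := by
  simpa only [Finset.filter_mem_eq_inter] using
    hD.filter (P := fun a v => v ∈ E a) ((hE.comp polyTime_fst).mem polyTime_snd)

theorem sdiff (hD : PolySet D) (hE : PolySet E) : PolySet fun a => D a \ E a := by
  simpa only [Finset.sdiff_eq_filter] using hD.filter (P := fun a v => v ∉ E a)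
    (((hE.comp polyTime_fst).mem polyTime_snd).not.congr fun _ => decide_not.symm)

end PolySet

namespace PolyOn

variable {α β γ : Type} [Code α] [Code β] [Code γ]

theorem ite_prop {D : ℕ → α → Prop} {P : α → Prop} [DecidablePred P] {f g : α → β}
    (hP : PolyOn D fun a => decide (P a)) (hf : PolyOn D f) (hg : PolyOn D g) :
    PolyOn D fun a => if P a then f a else g a := by
  simpa only [decide_eq_true_eq] using hP.ite hf hg

theorem up {f : α → β} (hf : PolyTime f) : PolyTime fun x : α × γ => f x.1 := hf.comp polyTime_fst

open DecompData

variable {w : α → List ℕ} {T : α → List Record} {x : α → Record} {p q : α → Profile}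
  {σ : α → ℕ → ℕ} {B D : α → Finset ℕ} {t s c u v : α → ℕ}

theorem entry (hp : PolyTime p) (hu : PolyTime u) : PolyTime fun a => entry (p a) (u a) :=
  hp.snd.getD hu ((nat 0).pair ((nat 0).pair (nat 0)))

theorem cls (hp : PolyTime p) (hu : PolyTime u) : PolyTime fun a => cls (p a) (u a) :=
  (hp.entry hu).fst

theorem isGood {κ δ m d : α → ℕ} (hκ : PolyTime κ) (hδ : PolyTime δ) (hm : PolyTime m)
    (hd : PolyTime d) : PolyTime fun a => isGood (κ a) (δ a) (m a) (d a) := by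
  simpa only [DecompData.isGood, Bool.decide_or, Bool.decide_and] using
    (hκ.eq (nat 0)).or (((hδ.le ((hm.add hm).add (nat 1))).and ((nat 1).le hd)).and
      ((hκ.le (nat 1)).or ((hm.add hm).le hδ)))

theorem join {n : α → ℕ} (hp : PolyTime p) (hq : PolyTime q) (hn : PolyTime n) :
    PolyTime fun a => join (p a) (q a) (n a) :=
  have hp' := hp.up.entry polyTime_snd
  have hq' := hq.up.entry polyTime_snd
  (hp.fst.add hq.fst).pair (hn.range.map (g := fun a u => (DecompData.cls (p a) u,
    (DecompData.entry (p a) u).2.1 + (DecompData.entry (q a) u).2.1,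
    (DecompData.entry (p a) u).2.2 + (DecompData.entry (q a) u).2.2))
    (hp'.fst.pair ((hp'.snd.fst.add hq'.snd.fst).pair (hp'.snd.snd.add hq'.snd.snd))))

theorem size (hσ : PolyTime fun x : α × ℕ => σ x.1 x.2) (hD : PolySet D) :
    PolyTime fun a => size (σ a) (D a) :=
  (hD.filter (P := fun a v => 1 ≤ σ a v) ((nat 1).le hσ)).card

theorem word_n (hw : PolyTime w) : PolyTime fun a => (ofWord (w a)).n := hw.getD (nat 0) (nat 0)

theorem word_N (hw : PolyTime w) : PolyTime fun a => (ofWord (w a)).N := hw.getD (nat 1) (nat 0)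

theorem word_r (hw : PolyTime w) : PolyTime fun a => (ofWord (w a)).r := hw.getD (nat 2) (nat 0)

theorem relationAt {o m n : α → ℕ} (hw : PolyTime w) (ho : PolyTime o) (hm : PolyTime m)
    (hn : PolyTime n) (hu : PolyTime u) (hv : PolyTime v) :
    PolyTime fun a => relationAt (w a) (o a) (m a) (n a) (u a) (v a) :=
  (((hu.add (nat 1)).le hm).and ((hv.add (nat 1)).le hn)).and
    ((hw.getD (ho.add (hv.add (hn.mul hu))) (nat 0)).eq (nat 1))

theorem adj (hw : PolyTime w) (hu : PolyTime u) (hv : PolyTime v) :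
    PolyTime fun a => (ofWord (w a)).adj (u a) (v a) :=
  hw.relationAt (nat _) hw.word_n hw.word_n hu hv

theorem child (hw : PolyTime w) (ht : PolyTime t) (hs : PolyTime s) :
    PolyTime fun a => (ofWord (w a)).child (t a) (s a) :=
  hw.relationAt ((nat 3).add (hw.word_n.mul hw.word_n)) hw.word_N hw.word_N ht hs

theorem bag (hw : PolyTime w) (ht : PolyTime t) (hv : PolyTime v) :
    PolyTime fun a => (ofWord (w a)).bag (t a) (v a) :=
  hw.relationAt (((nat 3).add (hw.word_n.mul hw.word_n)).add (hw.word_N.mul hw.word_N))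
    hw.word_N hw.word_n ht hv

theorem bagSet (hw : PolyTime w) (ht : PolyTime t) :
    PolySet fun a => (ofWord (w a)).bagSet (t a) :=
  (PolySet.range hw.word_n).filter (P := fun a v => (ofWord (w a)).bag (t a) v = true)
    ((hw.up.bag ht.up polyTime_snd).congr fun _ => (Bool.decide_coe _).symm)

theorem deg (hw : PolyTime w) (hu : PolyTime u) : PolyTime fun a => (ofWord (w a)).deg (u a) :=
  ((PolySet.range hw.word_n).filter (P := fun a v => (ofWord (w a)).adj (u a) v = true)
    ((hw.up.adj hu.up polyTime_snd).congr fun _ => (Bool.decide_coe _).symm)).card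

theorem nb (hw : PolyTime w) (hσ : PolyTime fun x : α × ℕ => σ x.1 x.2) (hD : PolySet D)
    (hc : PolyTime c) (hu : PolyTime u) :
    PolyTime fun a => (ofWord (w a)).nb (σ a) (D a) (c a) (u a) :=
  (hD.filter (P := fun a v => (ofWord (w a)).adj (u a) v = true ∧ c a ≤ σ a v)
    (((hw.up.adj hu.up polyTime_snd).and (hc.up.le hσ)).congr fun _ => by
      rw [Bool.decide_and, Bool.decide_coe])).card

theorem profile (hw : PolyTime w) (hσ : PolyTime fun x : α × ℕ => σ x.1 x.2) (hB : PolySet B)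
    (hD : PolySet D) : PolyTime fun a => (ofWord (w a)).profile (σ a) (B a) (D a) := by
  have hσ' : PolyTime fun x : (α × ℕ) × ℕ => σ x.1.1 x.2 :=
    hσ.comp (polyTime_fst.fst.pair polyTime_snd)
  have hnb := fun c => hw.up.nb (σ := fun x : α × ℕ => σ x.1) hσ' (hD.comp polyTime_fst) (nat c)
    polyTime_snd
  exact (size hσ hD).pair (hw.word_n.range.map (g := fun a u => if u ∈ B a then
    (σ a u, (ofWord (w a)).nb (σ a) (D a) 1 u, (ofWord (w a)).nb (σ a) (D a) 2 u) else (0, 0, 0))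
    (((hB.comp polyTime_fst).mem polyTime_snd).ite_prop (hσ.pair ((hnb 1).pair (hnb 2)))
      ((nat 0).pair ((nat 0).pair (nat 0)))))

theorem forget (hw : PolyTime w) (ht : PolyTime t) (hs : PolyTime s) (hp : PolyTime p) :
    PolyTime fun a => (ofWord (w a)).forget (t a) (s a) (p a) := by
  have hcls := (hp.up (γ := ℕ)).cls polyTime_snd
  have hD := (hw.bagSet hs).sdiff (hw.bagSet ht)
  have hnb : ∀ c, PolyTime fun x : α × ℕ => (ofWord (w x.1)).nb (DecompData.cls (p x.1))
      ((ofWord (w x.1)).bagSet (s x.1) \ (ofWord (w x.1)).bagSet (t x.1)) c x.2 := fun c =>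
    hw.up.nb (hp.up.up.cls polyTime_snd) (hD.comp polyTime_fst) (nat c) polyTime_snd
  have hentry := (hp.up (γ := ℕ)).entry polyTime_snd
  exact (hp.fst.add (size hcls hD)).pair (hw.word_n.range.map (g := fun a u => _)
    (((((hw.bagSet hs).inter (hw.bagSet ht)).comp polyTime_fst).mem polyTime_snd).ite_prop
      (hcls.pair ((hentry.snd.fst.add (hnb 1)).pair (hentry.snd.snd.add (hnb 2))))
      ((nat 0).pair ((nat 0).pair (nat 0)))))

theorem isClosed (hw : PolyTime w) (ht : PolyTime t) (hs : PolyTime s) (hp : PolyTime p) :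
    PolyTime fun a => (ofWord (w a)).isClosed (t a) (s a) (p a) := by
  have hnb : ∀ c, PolyTime fun x : α × ℕ => (ofWord (w x.1)).nb (DecompData.cls (p x.1))
      ((ofWord (w x.1)).bagSet (s x.1)) c x.2 := fun c =>
    hw.up.nb (hp.up.up.cls polyTime_snd) (hw.up.bagSet hs.up) (nat c) polyTime_snd
  have hentry := (hp.up (γ := ℕ)).entry polyTime_snd
  exact ((hw.bagSet hs).sdiff (hw.bagSet ht)).forall_mem (P := fun a u => _ = true)
    ((isGood hentry.fst (hw.up.deg polyTime_snd) (hentry.snd.fst.add (hnb 1))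
      (hentry.snd.snd.add (hnb 2))).congr fun _ => (Bool.decide_coe _).symm)

theorem isCompatible (hw : PolyTime w) (ht : PolyTime t) (hs : PolyTime s) (hp : PolyTime p)
    (hq : PolyTime q) : PolyTime fun a => (ofWord (w a)).isCompatible (t a) (s a) (p a) (q a) :=
  ((hw.bagSet hs).inter (hw.bagSet ht)).forall_mem
    (P := fun a u => DecompData.cls (p a) u = DecompData.cls (q a) u)
    ((hp.up.cls polyTime_snd).eq (hq.up.cls polyTime_snd))

theorem isStep {p' : α → Profile} (hw : PolyTime w) (ht : PolyTime t) (hs : PolyTime s)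
    (hp : PolyTime p) (hq : PolyTime q) (hp' : PolyTime p') :
    PolyTime fun a => (ofWord (w a)).isStep (t a) (s a) (p a) (q a) (p' a) :=
  ((hw.isClosed ht hs hq).and (hw.isCompatible ht hs hp hq)).and
    (hp'.eq (hp.join (hw.forget ht hs hq) hw.word_n))

theorem isStepFrom (hw : PolyTime w) (hT : PolyTime T) (ht : PolyTime t) (hs : PolyTime s)
    (hp : PolyTime p) : PolyTime fun a => (ofWord (w a)).isStepFrom (T a) (t a) (s a) (p a) := by
  have hf := polyTime_snd (α := α) (β := Record)
  have hg := polyTime_snd (α := α × Record) (β := Record)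
  have hchild := hT.up.any (p := fun (y : α × Record) g =>
    (decide (g.1 = s y.1) && decide (g.2.1 = (ofWord (w y.1)).N)) &&
      (ofWord (w y.1)).isStep (t y.1) (s y.1) y.2.2.2 g.2.2 (p y.1))
    (((hg.fst.eq hs.up.up).and (hg.snd.fst.eq hw.word_N.up.up)).and
      (hw.up.up.isStep ht.up.up hs.up.up hf.snd.snd.up hg.snd.snd hp.up.up))
  simpa only [DecompData.isStepFrom, Bool.decide_and] using hT.any (p := fun a f =>
    (decide (f.1 = t a) && decide (f.2.1 = s a)) && (T a).any fun g =>
      (decide (g.1 = s a) && decide (g.2.1 = (ofWord (w a)).N)) &&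
        (ofWord (w a)).isStep (t a) (s a) f.2.2 g.2.2 (p a))
    (((hf.fst.eq ht.up).and (hf.snd.fst.eq hs.up)).and hchild)

theorem follows (hw : PolyTime w) (hT : PolyTime T) (hx : PolyTime x) :
    PolyTime fun a => (ofWord (w a)).follows (T a) (x a) := by
  have hp := hx.snd.snd
  have hj := hx.snd.fst.sub (nat 1)
  have hmem : PolyTime fun a => decide (((x a).1, (x a).2.1 - 1, (x a).2.2) ∈ T a) :=
    ((hx.fst.pair (hj.pair hp)).decide_mem hT).congr fun _ => decide_eq_decide.2 .rfl
  refine ((hx.snd.fst.eq (nat 0)).ite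
    (hp.eq (hw.profile (σ := fun a => DecompData.cls (x a).2.2) (hp.up.cls polyTime_snd)
      (hw.bagSet hx.fst) .empty))
    ((hw.child hx.fst hj).ite (hw.isStepFrom hT hx.fst hj hp) hmem)).congr fun a => ?_
  obtain ⟨t, _ | j, p⟩ := x a <;> simp [DecompData.follows]

theorem options (hw : PolyTime w) (ht : PolyTime t) (hv : PolyTime v) :
    PolyTime fun a => (ofWord (w a)).options (t a) (v a) :=
  have hn := (hw.word_n.add (nat 1)).range
  (hw.bag ht hv).ite ((nat 3).range.product (hn.product hn))
    (((nat 0).pair ((nat 0).pair (nat 0))).cons nil)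

end PolyOn

/-- Words such that the number of states of a node is considered as part of the size. -/
structure StateWord where
  word : List ℕ

namespace StateWord

open DecompData

/-- A bound for the entries of a word and for the numbers of states of the nodes. -/
def IsBound (B : ℕ) (w : List ℕ) : Prop :=
  Code.Bdd B w ∧ ∀ t, ((ofWord w).states t).length ≤ B

instance : Code StateWord where
  Stored mem free v w := Code.Stored mem free v w.word
  Bdd B w := IsBound B w.word
  stored_mono := Code.stored_mono (α := List ℕ)
  bdd_mono _ _ hB _ h := ⟨h.1.mono hB, fun t => (h.2 t).trans hB⟩

theorem polyTime_word : PolyTime word :=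
  .of_same_stored (.of_imp fun _ _ h => h.1) fun _ _ _ _ _ _ h => h

theorem polyTime_states : PolyTime fun x : StateWord × ℕ => (ofWord x.1.word).states x.2 := by
  have hw := polyTime_word.comp (polyTime_fst (β := ℕ))
  refine (hw.word_n.range.map (g := fun (x : StateWord × ℕ) v => (ofWord x.1.word).options x.2 v)
    (hw.up.options polyTime_snd.up polyTime_snd)).sections (fun x h => ?_)
    (.of_imp fun B x h => h.1.2 x.2)
  obtain ⟨v, -, hv⟩ := List.mem_map.1 h
  rw [DecompData.options] at hv
  split at hv
  · exact List.ne_nil_of_mem (a := (0, 0, 0)) (by simp) hv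
  · exact List.cons_ne_nil _ _ hv

theorem polyTime_candidates : PolyTime fun w : StateWord => (ofWord w.word).candidates :=
  have hw := polyTime_word.comp (polyTime_fst (β := ℕ))
  polyTime_word.word_N.range.flatMap (g := fun _ _ => _) ((polyTime_snd.cons .nil).product
    ((hw.word_N.add (.nat 1)).range.product ((hw.word_n.add (.nat 1)).range.product
      polyTime_states)))

theorem polyTime_table : PolyTime fun x : StateWord × ℕ => (ofWord x.1.word).table x.2 := by
  have hw := polyTime_word.comp (polyTime_fst (β := ℕ))
  refine .iterate (h := fun (x : StateWord × ℕ) T => (ofWord x.1.word).candidates.filter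
    ((ofWord x.1.word).follows T)) .nil polyTime_snd
    ((polyTime_candidates.comp polyTime_fst.fst).filter
      (p := fun (y : (StateWord × ℕ) × List Record) => (ofWord y.1.1.word).follows y.2)
      (hw.up.up.follows polyTime_snd.up polyTime_snd)) (.refl _) ?_
  refine ((polyTime_candidates.comp polyTime_fst).1).map .id fun B x h i _ => ?_
  cases i with
  | zero => exact ⟨Nat.zero_le _, fun _ hr => absurd hr List.not_mem_nil⟩
  | succ i =>
    rw [Function.iterate_succ_apply']
    exact Code.bdd_of_subset h (List.length_filter_le _ _) List.filter_sublist.subset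

theorem polyTime_answer : PolyTime fun w : StateWord => (ofWord w.word).answer := by
  have hw := polyTime_word
  have hx := polyTime_snd (α := StateWord) (β := Record)
  have htable := polyTime_table.comp (polyTime_id.pair (hw.word_N.mul (hw.word_N.add (.nat 1))))
  have hroot : PolyTime fun x : StateWord × Record =>
      decide (x.2.1 = (ofWord x.1.word).r ∧ x.2.2.1 = (ofWord x.1.word).N) &&
        (ofWord x.1.word).isClosed (ofWord x.1.word).N (ofWord x.1.word).r x.2.2.2 := by
    simpa only [Bool.decide_and] using ((hx.fst.eq hw.word_r.up).and
      (hx.snd.fst.eq hw.word_N.up)).and (hw.up.isClosed hw.word_N.up hw.word_r.up hx.snd.snd)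
  exact ((htable.filter hroot).map (g := fun w x => _)
    (hw.up.forget hw.word_N.up hw.word_r.up hx.snd.snd).fst).foldl_max (.nat 1)

theorem polyOn_answer : PolyOn IsBound fun w => (ofWord w).answer :=
  polyTime_answer.comp (f := mk) (.of_same_stored (.refl _) fun _ _ _ _ _ _ h => h)

end StateWord

/-! ## Locally minimal defensive alliances -/

section Alliance

variable {V : Type*} {G : SimpleGraph V} {S : Finset V} {u v : V}

/-- A vertex is marginally protected in an alliance `S` if its protection fails when a neighbour
leaves `S`. -/
def IsMarginallyProtected (G : SimpleGraph V) (S : Finset V) (v : V) : Prop :=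
  2 * (G.neighborSet v ∩ S).ncard ≤ (G.neighborSet v).ncard

theorem isDefensiveAlliance_iff [Finite V] : IsDefensiveAlliance G S ↔ S.Nonempty ∧ ∀ v ∈ S,
    (G.neighborSet v).ncard ≤ 2 * (G.neighborSet v ∩ S).ncard + 1 := by
  refine and_congr_right fun _ => forall₂_congr fun v hv => ?_
  have hdiff := Set.ncard_inter_add_ncard_sdiff_eq_ncard (G.neighborSet v) (S : Set V)
  have hinsert : (insert v (G.neighborSet v) ∩ (S : Set V)).ncard =
      (G.neighborSet v ∩ (S : Set V)).ncard + 1 := by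
    rw [Set.insert_inter_of_mem hv, Set.ncard_insert_of_notMem fun h => G.irrefl h.1]
  omega

variable [DecidableEq V]

theorem neighborSet_inter_erase (h : ¬ G.Adj u v) :
    G.neighborSet u ∩ (S.erase v : Finset V) = G.neighborSet u ∩ (S : Set V) := by
  rw [Finset.coe_erase, ← Set.inter_sdiff_assoc]
  exact Set.sdiff_singleton_eq_self fun hv => h hv.1

variable [Finite V]

theorem ncard_neighborSet_inter_erase (hv : v ∈ S) (h : G.Adj u v) :
    (G.neighborSet u ∩ (S.erase v : Finset V)).ncard + 1 =
      (G.neighborSet u ∩ (S : Set V)).ncard := by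
  rw [Finset.coe_erase, ← Set.inter_sdiff_assoc]
  exact Set.ncard_sdiff_singleton_add_one ⟨h, hv⟩

theorem IsDefensiveAlliance.isLocallyMinimal (hS : IsDefensiveAlliance G S)
    (h : ∀ v ∈ S, ∃ u ∈ S, G.Adj v u ∧ IsMarginallyProtected G S u) :
    IsLocallyMinimalDefensiveAlliance G S := by
  refine ⟨hS, fun v hv hv' => ?_⟩
  obtain ⟨u, hu, huv, hd⟩ := h v hv
  have hprot := (isDefensiveAlliance_iff.1 hv').2 u (Finset.mem_erase.2 ⟨huv.ne', hu⟩)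
  have hcard := ncard_neighborSet_inter_erase hv huv.symm
  rw [IsMarginallyProtected] at hd
  omega

theorem IsLocallyMinimalDefensiveAlliance.exists_isMarginallyProtected
    (hS : IsLocallyMinimalDefensiveAlliance G S) (hcard : 2 ≤ S.card) (hv : v ∈ S) :
    ∃ u ∈ S, G.Adj v u ∧ IsMarginallyProtected G S u := by
  have hne : (S.erase v).Nonempty := by
    rw [← Finset.card_pos, Finset.card_erase_of_mem hv]
    omega
  have h := hS.2 v hv
  rw [isDefensiveAlliance_iff, not_and] at h
  push Not at h
  obtain ⟨u, hu, hd⟩ := h hne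
  have hu := Finset.mem_of_mem_erase hu
  have hprot := (isDefensiveAlliance_iff.1 hS.1).2 u hu
  by_cases huv : G.Adj u v
  · have := ncard_neighborSet_inter_erase hv huv
    refine ⟨u, hu, huv.symm, ?_⟩
    rw [IsMarginallyProtected]
    omega
  · rw [neighborSet_inter_erase huv] at hd
    omega

theorem exists_isLocallyMinimalDefensiveAlliance [Nonempty V] (G : SimpleGraph V) :
    ∃ S, IsLocallyMinimalDefensiveAlliance G S := by
  cases nonempty_fintype V
  have hne : {S : Finset V | IsDefensiveAlliance G S}.Nonempty :=
    ⟨Finset.univ, isDefensiveAlliance_iff.2 ⟨Finset.univ_nonempty, fun v _ => by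
      rw [Finset.coe_univ, Set.inter_univ]
      omega⟩⟩
  obtain ⟨S, hS, hmin⟩ := WellFounded.has_min (measure Finset.card).wf _ hne
  exact ⟨S, hS, fun v hv hv' => hmin _ hv' (Finset.card_erase_lt_of_mem hv)⟩

end Alliance

namespace DecompData

variable {n N : ℕ} {G : SimpleGraph (Fin n)} {T : SimpleGraph (Fin N)} {r : Fin N}
  {X : Fin N → Finset (Fin n)} {σ : ℕ → ℕ}

open Finset

theorem card_filter_range (n : ℕ) (P : ℕ → Prop) [DecidablePred P] :
    #{v ∈ range n | P v} = {v : Fin n | P v}.ncard := by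
  rw [← Nat.Iio_eq_range, ← Fin.map_valEmbedding_univ, filter_map, card_map, ← Set.ncard_coe_finset,
    coe_filter_univ]
  rfl

theorem deg_ofGraph (v : Fin n) : (ofGraph G T r X).deg v = (G.neighborSet v).ncard :=
  (card_filter_range n _).trans (congrArg _ (Set.ext fun u => by
    simp [adj_ofGraph, Relation.Map, ← Fin.ext_iff]))

theorem nb_ofGraph (c : ℕ) (v : Fin n) : (ofGraph G T r X).nb σ (range n) c v =
    (G.neighborSet v ∩ {u : Fin n | c ≤ σ u}).ncard :=
  (card_filter_range n _).trans (congrArg _ (Set.ext fun u => by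
    simp [adj_ofGraph, Relation.Map, ← Fin.ext_iff]))

theorem good_ofGraph {S : Finset (Fin n)} (hS : ∀ v : Fin n, 1 ≤ σ v ↔ v ∈ S) (v : Fin n) :
    (ofGraph G T r X).Good σ v ↔ (v ∈ S →
      (G.neighborSet v).ncard ≤ 2 * (G.neighborSet v ∩ S).ncard + 1 ∧
      (∃ u : Fin n, G.Adj v u ∧ 2 ≤ σ u) ∧ (2 ≤ σ v → IsMarginallyProtected G S v)) := by
  have hS' : {u : Fin n | 1 ≤ σ u} = S := Set.ext hS
  have hex : (∃ u : Fin n, G.Adj v u ∧ 2 ≤ σ u) ↔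
      1 ≤ (G.neighborSet v ∩ {u : Fin n | 2 ≤ σ u}).ncard := by
    rw [Nat.succ_le_iff, Set.ncard_pos]
    rfl
  have hnb := nb_ofGraph (G := G) (T := T) (r := r) (X := X) (σ := σ) (v := v)
  rw [Good, deg_ofGraph, show (ofGraph G T r X).n = n from rfl, hnb, hnb, hex, hS', ← hS v,
    IsMarginallyProtected, isGood, decide_eq_true_iff]
  omega

theorem size_ofGraph {S : Finset (Fin n)} (hS : ∀ v : Fin n, 1 ≤ σ v ↔ v ∈ S) :
    size σ (range n) = #S :=
  (card_filter_range n _).trans ((congrArg _ (Set.ext hS)).trans (Set.ncard_coe_finset S))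

theorem exists_alliance_of_good (hσ : ∀ v < n, (ofGraph G T r X).Good σ v)
    (hpos : 1 ≤ size σ (range n)) :
    ∃ S, IsLocallyMinimalDefensiveAlliance G S ∧ #S = size σ (range n) := by
  let S : Finset (Fin n) := {v | 1 ≤ σ v}
  have hS : ∀ v : Fin n, 1 ≤ σ v ↔ v ∈ S := fun v => by simp [S]
  have hgood := fun v : Fin n => (good_ofGraph hS v).1 (hσ v v.2)
  rw [size_ofGraph hS] at hpos ⊢
  have hall : IsDefensiveAlliance G S :=
    isDefensiveAlliance_iff.2 ⟨card_pos.1 hpos, fun v hv => (hgood v hv).1⟩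
  refine ⟨S, hall.isLocallyMinimal fun v hv => ?_, rfl⟩
  obtain ⟨u, huv, hu⟩ := (hgood v hv).2.1
  have huS : u ∈ S := (hS u).1 (by omega)
  exact ⟨u, huS, huv, (hgood u huS).2.2 hu⟩

theorem exists_good_of_alliance {S : Finset (Fin n)} (hS : IsLocallyMinimalDefensiveAlliance G S)
    (hcard : 2 ≤ #S) : ∃ σ, (∀ v, σ v ≤ 2) ∧ (∀ v < n, (ofGraph G T r X).Good σ v) ∧
      size σ (range n) = #S := by
  classical
  let κ : Fin n → ℕ := fun v => if v ∈ S then if IsMarginallyProtected G S v then 2 else 1 else 0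
  let σ : ℕ → ℕ := Function.extend Fin.val κ 0
  have hσ : ∀ v : Fin n, σ v = κ v := Fin.val_injective.extend_apply _ _
  have one_le_iff : ∀ v : Fin n, 1 ≤ σ v ↔ v ∈ S := fun v => by grind
  have two_le_iff : ∀ v : Fin n, 2 ≤ σ v ↔ v ∈ S ∧ IsMarginallyProtected G S v := fun v => by
    grind
  refine ⟨σ, fun v => ?_, fun v hv => (good_ofGraph one_le_iff ⟨v, hv⟩).2 fun hvS => ?_,
    size_ofGraph one_le_iff⟩
  · by_cases hv : v < n
    · rw [hσ ⟨v, hv⟩]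
      grind
    · exact (Function.extend_apply' _ _ _ fun ⟨u, hu⟩ => hv (hu ▸ u.2)).trans_le (Nat.zero_le 2)
  · obtain ⟨u, hu, huv, hd⟩ := hS.exists_isMarginallyProtected hcard hvS
    exact ⟨(isDefensiveAlliance_iff.1 hS.1).2 _ hvS, ⟨u, huv, (two_le_iff u).2 ⟨hu, hd⟩⟩,
      fun h => ((two_le_iff _).1 h).2⟩

theorem isGreatest_answer (hn : 1 ≤ n) (hX : IsTreeDecomposition G T X) :
    IsGreatest {a | ∃ S, IsLocallyMinimalDefensiveAlliance G S ∧ #S = a}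
      (ofGraph G T r X).answer := by
  have hI := isDecomposition_ofGraph (r := r) hX
  have hpos := one_le_answer (I := ofGraph G T r X)
  have hub : ∀ S, IsLocallyMinimalDefensiveAlliance G S → #S ≤ (ofGraph G T r X).answer := by
    intro S hS
    by_cases hcard : 2 ≤ #S
    · obtain ⟨σ, hσ, hg, hsize⟩ := exists_good_of_alliance (T := T) (r := r) (X := X) hS hcard
      exact hsize ▸ hI.size_le_answer hσ hg
    · omega
  refine ⟨?_, fun a ⟨S, hS, ha⟩ => ha ▸ hub S hS⟩
  by_cases h : (ofGraph G T r X).answer = 1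
  · have : Nonempty (Fin n) := ⟨⟨0, hn⟩⟩
    obtain ⟨S, hS⟩ := exists_isLocallyMinimalDefensiveAlliance G
    have hSpos := card_pos.2 hS.1.1
    exact ⟨S, hS, le_antisymm (hub S hS) (h ▸ hSpos)⟩
  · obtain ⟨σ, hσ, hsize⟩ := hI.exists_of_answer_ne_one h
    obtain ⟨S, hS, hcard⟩ := exists_alliance_of_good hσ (hpos.trans_eq hsize.symm)
    exact ⟨S, hS, hcard.trans hsize⟩

end DecompData

/-! ## The size of the tables -/

theorem length_sections {α : Type*} (L : List (List α)) :
    L.sections.length = (L.map List.length).prod := by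
  induction L with
  | nil => rfl
  | cons l L ih => simp [List.sections, List.length_flatMap, ih, mul_comm]

namespace DecompData

open Finset

theorem length_options (I : DecompData) (t v : ℕ) :
    (I.options t v).length = if I.bag t v then 3 * (I.n + 1) ^ 2 else 1 := by
  rw [options]
  split
  · simp [List.length_product, pow_two]
  · rfl

theorem length_states (I : DecompData) (t : ℕ) :
    (I.states t).length = (3 * (I.n + 1) ^ 2) ^ #(I.bagSet t) := by
  have hprod : (((List.range I.n).map (I.options t)).map List.length).prod =
      ∏ v ∈ range I.n, if I.bag t v then 3 * (I.n + 1) ^ 2 else 1 := by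
    simp only [List.map_map, Function.comp_def, length_options]
    rfl
  rw [states, length_sections, hprod, ← prod_filter, prod_const, bagSet]

variable {n N k : ℕ} {G : SimpleGraph (Fin n)} {T : SimpleGraph (Fin N)} {r : Fin N}
  {X : Fin N → Finset (Fin n)}

theorem bagSet_ofGraph (t : Fin N) :
    (ofGraph G T r X).bagSet t = (X t).map Fin.valEmbedding := by
  ext v
  rw [mem_bagSet, bag_ofGraph, mem_map]
  constructor
  · rintro ⟨-, t', v, hv, ht, rfl⟩
    exact ⟨v, Fin.val_injective ht ▸ hv, rfl⟩
  · rintro ⟨v, hv, rfl⟩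
    exact ⟨v.2, t, v, hv, rfl, rfl⟩

theorem card_bagSet_ofGraph_le (hk : bagWidth X ≤ k) (t : ℕ) :
    #((ofGraph G T r X).bagSet t) ≤ k + 1 := by
  obtain h | ⟨v, hv⟩ := ((ofGraph G T r X).bagSet t).eq_empty_or_nonempty
  · exact (card_eq_zero.2 h).trans_le (Nat.zero_le _)
  · obtain ⟨t, -, -, rfl, -⟩ := bag_ofGraph.1 (mem_bagSet.1 hv).2
    rw [bagSet_ofGraph, card_map]
    exact (le_sup (f := fun t => #(X t)) (mem_univ t)).trans (Nat.sub_le_iff_le_add.1 hk)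

theorem states_pow_le {m : ℕ} (hn : 1 ≤ n) (hk : m ≤ k + 1) (hm : m ≤ n) :
    (3 * (n + 1) ^ 2) ^ m ≤ 12 * (n ^ (k + 1)) ^ 6 := by
  obtain rfl | hn : n = 1 ∨ 2 ≤ n := by omega
  · simpa using Nat.pow_le_pow_right (n := 12) (by norm_num) hm
  have hbase : 3 * (n + 1) ^ 2 ≤ n ^ 6 := by
    have h₁ : n + 1 ≤ n ^ 2 := by nlinarith
    calc 3 * (n + 1) ^ 2 ≤ n ^ 2 * (n ^ 2) ^ 2 :=
          Nat.mul_le_mul (by nlinarith) (Nat.pow_le_pow_left h₁ 2)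
      _ = n ^ 6 := by ring
  calc (3 * (n + 1) ^ 2) ^ m ≤ (n ^ 6) ^ (k + 1) :=
        (Nat.pow_le_pow_left hbase m).trans (Nat.pow_le_pow_right (by positivity) hk)
    _ = (n ^ (k + 1)) ^ 6 := pow_right_comm ..
    _ ≤ 12 * (n ^ (k + 1)) ^ 6 := Nat.le_mul_of_pos_left _ (by norm_num)

theorem length_states_ofGraph_le (hn : 1 ≤ n) (hk : bagWidth X ≤ k) (t : ℕ) :
    ((ofGraph G T r X).states t).length ≤ 12 * (n ^ (k + 1)) ^ 6 := by
  rw [length_states]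
  exact states_pow_le hn (card_bagSet_ofGraph_le hk t)
    ((card_le_card bagSet_subset).trans_eq (card_range n))

theorem bdd_inputWord : Code.Bdd (3 + n * n + N * N + N * n) (inputWord G T r X) := by
  refine ⟨length_inputWord.le, fun a ha => ?_⟩
  have hn := Nat.le_mul_self n
  have hN := Nat.le_mul_self N
  have hr := r.2
  change a ≤ _
  simp only [inputWord, List.mem_append, List.mem_cons, List.not_mem_nil, or_false] at ha
  obtain (((rfl | rfl | rfl) | ha) | ha) | ha := ha
  iterate 3 omega
  all_goals
    have := le_one_of_mem_relationMatrix ha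
    omega

theorem isBound_inputWord (hn : 1 ≤ n) (hk : bagWidth X ≤ k) :
    StateWord.IsBound (12 * (n ^ (k + 1)) ^ 6 + (3 + n * n + N * N + N * n))
      (inputWord G T r X) :=
  ⟨bdd_inputWord.mono (Nat.le_add_left _ _),
    fun t => (length_states_ofGraph_le hn hk t).trans (Nat.le_add_right _ _)⟩

end DecompData

theorem size_bound_le {n N M c : ℕ} (hn : 1 ≤ n) (hM : n ≤ M) (hN : N ≤ c * n ^ c) :
    12 * M ^ 6 + (3 + n * n + N * N + N * n) + 2 ≤
      (18 + c ^ 2 + c) * M ^ (2 * (c + 3)) := by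
  have hM' : 1 ≤ M := hn.trans hM
  obtain ⟨y, hy⟩ : ∃ y, y = M ^ (c + 3) := ⟨_, rfl⟩
  have pow_le : ∀ i ≤ c + 3, M ^ i ≤ y := fun i hi => hy ▸ Nat.pow_le_pow_right hM' hi
  have hny : n ≤ y := hM.trans ((pow_one M).symm.trans_le (pow_le 1 (by omega)))
  have hNy : N ≤ c * y := hN.trans <|
    Nat.mul_le_mul_left c ((Nat.pow_le_pow_left hM c).trans (pow_le c (by omega)))
  have hy₁ : 1 ≤ y := hn.trans hny
  rw [mul_comm 2, pow_mul, ← hy]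
  calc 12 * M ^ 6 + (3 + n * n + N * N + N * n) + 2
      = 12 * (M ^ 3) ^ 2 + (5 * 1 ^ 2 + n * n + N * N + N * n) := by ring
    _ ≤ 12 * y ^ 2 + (5 * y ^ 2 + y * y + c * y * (c * y) + c * y * y) := by
        gcongr
        exact pow_le 3 (by omega)
    _ = (18 + c ^ 2 + c) * y ^ 2 := by ring

theorem mainTheorem4_general :
    ∃ P : RAM.Program, ∀ c : ℕ, ∃ C : ℕ,
      ∀ (n N k : ℕ) (G : SimpleGraph (Fin n)) (T : SimpleGraph (Fin N)) (r : Fin N)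
        (X : Fin N → Finset (Fin n)),
        1 ≤ n → N ≤ c * n ^ c →
        IsTreeDecomposition G T X → bagWidth X ≤ k →
        ∃ t m : ℕ, RAM.Outputs P (inputWord G T r X) t m ∧
          t ≤ C * n ^ (C * (k + 1)) ∧
          IsGreatest {a | ∃ S, IsLocallyMinimalDefensiveAlliance G S ∧ S.card = a} m := by
  obtain ⟨P, E, hP⟩ := exists_program StateWord.polyOn_answer fun _ _ h => h.1
  refine ⟨P, fun c => ⟨(18 + c ^ 2 + c) ^ E + 2 * (c + 3) * E, ?_⟩⟩
  intro n N k G T r X hn hN hX hk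
  obtain ⟨t, ht, hout⟩ := hP _ _ (DecompData.isBound_inputWord (G := G) (T := T) (r := r) hn hk)
    (length_inputWord.trans (by rw [mul_add, ← add_assoc]; rfl))
  refine ⟨t, _, hout, ?_, DecompData.isGreatest_answer hn hX⟩
  calc t ≤ ((18 + c ^ 2 + c) * (n ^ (k + 1)) ^ (2 * (c + 3))) ^ E :=
        ht.trans (Nat.pow_le_pow_left (size_bound_le hn (Nat.le_self_pow k.succ_ne_zero n) hN) E)
    _ = (18 + c ^ 2 + c) ^ E * n ^ (2 * (c + 3) * E * (k + 1)) := by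
        rw [mul_pow, ← pow_mul, ← pow_mul, mul_assoc, mul_comm (k + 1)]
    _ ≤ _ := by
        gcongr
        · exact Nat.le_add_right _ _
        · exact Nat.le_add_left _ _

theorem mainTheorem4 :
    ∃ P : RAM.Program, ∀ c : ℕ, ∃ C : ℕ,
      ∀ (n N k : ℕ) (G : SimpleGraph (Fin n)) (T : SimpleGraph (Fin N)) (r : Fin N)
        (X : Fin N → Finset (Fin n)),
        1 ≤ n → N ≤ c * n ^ c →
        IsNiceTreeDecomposition G T r X → bagWidth X ≤ k →
        ∃ t m : ℕ, RAM.Outputs P (inputWord G T r X) t m ∧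
          t ≤ C * 8 ^ k * n ^ (C * 2 ^ (k + 1)) ∧
          IsGreatest {a | ∃ S, IsLocallyMinimalDefensiveAlliance G S ∧ S.card = a} m := by
  refine mainTheorem4_general.imp fun P hP c => (hP c).imp fun C hC n N k G T r X hn hN hX hk => ?_
  obtain ⟨t, m, hout, ht, hm⟩ := hC n N k G T r X hn hN hX.toIsTreeDecomposition hk
  exact ⟨t, m, hout, ht.trans (Nat.mul_le_mul (Nat.le_mul_of_pos_right C (by positivity))
    (Nat.pow_le_pow_right hn (Nat.mul_le_mul_left C Nat.lt_two_pow_self.le))), hm⟩
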